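/- **Setting.** On a filtered probability space $(\Omega,\mathcal F,(\mathcal F_t)_{t\in[0,1]},P)$ satisfying the usual conditions, let the log-prices of $p$ assets follow the jump-diffusion $$d\mathbf X(t)=d\mathbf X^c(t)+\mathbf L(t)\,d\boldsymbol\Lambda(t)=\boldsymbol\mu(t)\,dt+\boldsymbol\sigma^\top(t)\,d\mathbf W_t+\mathbf L(t)\,d\boldsymbol\Lambda(t),\qquad \mathbf X^c(0)=\mathbf X(0),$$ where $\mathbf W$ is a $q$-dimensional standard Brownian motion ($q$ arbitrary), $\boldsymbol\Lambda$ is a $p$-dimensional Poisson process with bounded deterministic intensity functions $I_i(t)$, and the jump sizes $\mathbf L$ are unrestricted. Put $\boldsymbol\gamma=\boldsymbol\sigma^\top\boldsymbol\sigma$. A sampling scheme consists of observation times $t_{i,0}<\dots<t_{i,n_i}$ in $[0,1]$ for each asset $i$, times $0=\tau_0<\tau_1<\dots<\tau_n=1$, and selected observation times $\tau_{i,k}\in(\tau_{k-1},\tau_k]\cap\{t_{i,l}\}$, $1\le k\le n$. One observes $Y_i(\tau_{i,k})=X_i(\tau_{i,k})+\epsilon_i(\tau_{i,k})$. The noise is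 independent of the price processes, the noise vectors at distinct observation times are independent, each $\epsilon_i(t)$ has mean zero and a law not depending on $t$, and $E[\epsilon_i(t)\epsilon_j(t)]=\eta_{ij}$. Let $Y_i^c=X_i^c+\epsilon_i$. Let $g$ be continuous on $[0,1]$, piecewise continuously differentiable with piecewise Lipschitz derivative, $g(0)=g(1)=0$, $\int_0^1g^2>0$. Let $C_K>0$ and let $K$ be $C_Kn^{1/2}$ rounded (up or down) to an integer. Put $\phi=\frac1K\sum_{l=0}^{K-1}g(l/K)^2$, $\zeta=\sum_{l=0}^{K-1}\{g(\frac lK)-g(\frac{l+1}K)\}^2$ and $$\rho_{ij}=\frac{\sum_{k=1}^n\mathbf 1(\tau_{i,k}=\tau_{j,k})}{\phi K}\,\zeta\,\eta_{ij},$$ $$Q_{\rho,ij}(\tau_k)=\tfrac12\{Y_i(\tau_{i,k+1})-Y_i(\tau_{i,k})\}\{Y_j(\tau_{j,k+1})-Y_j(\tau_{j,k})\},\quad 1\le k\le n-1,$$ and let $Q^c_{\rho,ij}$ be the same expression with $Y^c$ in place of $Y$. Let $Z_i^c(\tau_k)=\sum_{l=0}^{K-1}g(\frac lK)\{Y_i^c(\tau_{i,k+l+1})-Y_i^c(\tau_{i,k+l})\}$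 and $Q^c_{ij}(\tau_k)=\frac{n-K}{\phi K}Z^c_i(\tau_k)Z^c_j(\tau_k)$, $1\le k\le n-K$. For tail indices $\alpha_1,\dots,\alpha_p\ge1$ put $\alpha_{ij}=2\wedge\frac{2\alpha_i\alpha_j}{\alpha_i+\alpha_j}$. **The class.** Fix $\nu_\mu,\nu_\gamma,\nu_I,\nu_Q,\nu_\rho>0$ and $C_\Delta\ge1$. For a scheme with $\max_k(\tau_k-\tau_{k-1})\le C_\Delta/n$, let $\Xi_\rho(\alpha_1,\dots,\alpha_p)$ be the class of all models as above with, almost surely, $|\mu_i(t)|\le\nu_\mu$ and $\gamma_{ii}(t)\le\nu_\gamma$ for all $i,t$, with $I_i(t)\le\nu_I$ for all $i,t$, with $E|Q^c_{ii}(\tau_k)|^{\alpha_i}\le\nu_Q$ for all $i$ and $1\le k\le n-K$, and with $$\max_{1\le i\le p}E|Q^c_{\rho,ii}(\tau_k)|^{\alpha_i}\le\nu_\rho\qquad\text{for all }1\le k\le n-1.$$ **Theorem 4.4 (lower bound).** Suppose $\alpha_{ij}\in(1,2)$ for some $1\le i,j\le p$. There is a constant $C>0$, depending only on $g$, $C_K$,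 the constants $\nu_\mu,\nu_\gamma,\nu_I,\nu_Q,\nu_\rho,C_\Delta$ and $\alpha_i,\alpha_j$ (in particular not on $n$, $p$, $\delta$), such that for every $c>0$, all sufficiently large $n$ (how large depends on the same quantities and on $c$, but not on $p$) and all $\delta$ with $\delta^{-1}\in[n^c,e^{n^{1/2}}]$, there is a sampling scheme with $\max_k(\tau_k-\tau_{k-1})\le C_\Delta/n$ for which $$\min_{\widehat\rho_{ij}}\ \max_{\Xi_\rho(\alpha_1,\dots,\alpha_p)}\Pr\Big\{\big|\widehat\rho_{ij}\big(Q_{\rho,ij}(\tau_1),\dots,Q_{\rho,ij}(\tau_{n-1}),\delta\big)-\rho_{ij}\big|\ge C\Big(\frac{\log\delta^{-1}}n\Big)^{(\alpha_{ij}-1)/\alpha_{ij}}\Big\}\ \ge\ \delta,$$ where the minimum is over all measurable functions $\widehat\rho_{ij}$ of the quadratic log-returns (possibly depending on $\delta$). That is, for every such estimator some model in the class has error probability at least $\delta$. -/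

import Mathlib

open MeasureTheory ProbabilityTheory Filter Topology
open scoped NNReal ENNReal unitInterval

noncomputable section

namespace RobustVol

/-! ### Tail index and pre-averaging weights -/

/-- The tail index `α_ij = 2 ∧ 2 α_i α_j / (α_i + α_j)` of a pair of assets. -/
def tailIndex (a b : ℝ) : ℝ := min 2 (2 * a * b / (a + b))

/-- Admissible weight functions on `[0, 1]`: continuous, piecewise continuously differentiable with
a piecewise Lipschitz derivative, vanishing at both end points, and not identically zero. -/
structure IsWeight (g : ℝ → ℝ) : Prop where
  cont : ContinuousOn g (Set.Icc 0 1)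
  zero : g 0 = 0
  one : g 1 = 0
  piecewise : ∃ (m : ℕ) (s : ℕ → ℝ), s 0 = 0 ∧ s m = 1 ∧ ∀ r < m, s r < s (r + 1) ∧
    ∃ (g' : ℝ → ℝ) (L : ℝ≥0), LipschitzOnWith L g' (Set.Ioo (s r) (s (r + 1))) ∧
      ∀ x ∈ Set.Ioo (s r) (s (r + 1)), HasDerivAt g (g' x) x
  sq_pos : 0 < ∫ t in (0 : ℝ)..1, g t ^ 2

/-- `φ = K⁻¹ ∑_{l < K} g(l/K)²`. -/
def phi (g : ℝ → ℝ) (K : ℕ) : ℝ :=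
  (1 / (K : ℝ)) * ∑ l ∈ Finset.range K, g ((l : ℝ) / K) ^ 2

/-- `ζ = ∑_{l < K} (g(l/K) - g((l+1)/K))²`. -/
def zeta (g : ℝ → ℝ) (K : ℕ) : ℝ :=
  ∑ l ∈ Finset.range K, (g ((l : ℝ) / K) - g (((l : ℝ) + 1) / K)) ^ 2

/-! ### Observation times and generalized sampling times -/

/-- Observation times of `p` assets together with a generalized sampling time `τ₀ < ⋯ < τₙ`.
The sequences are indexed by `ℕ`; only the indices named in the laws are meaningful:
`τ k` for `k ≤ n`, the `l`-th observation time `obs i l` of asset `i` for `l ≤ N i`, and the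
selected index `sel i k`, so that `τ_{i,k} = obs i (sel i k)`, for `1 ≤ k ≤ n`. -/
structure SamplingScheme (p n : ℕ) where
  τ : ℕ → I
  τ_zero : τ 0 = 0
  τ_last : τ n = 1
  τ_lt : ∀ k < n, τ k < τ (k + 1)
  N : Fin p → ℕ
  obs : Fin p → ℕ → I
  obs_strictMono : ∀ i, StrictMonoOn (obs i) (Set.Iic (N i))
  sel : Fin p → ℕ → ℕ
  sel_le : ∀ i, ∀ k ∈ Finset.Icc 1 n, sel i k ≤ N i
  sel_mem : ∀ i, ∀ k ∈ Finset.Icc 1 n, obs i (sel i k) ∈ Set.Ioc (τ (k - 1)) (τ k)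

namespace SamplingScheme

variable {p n : ℕ} (S : SamplingScheme p n)

/-- The selected observation time `τ_{i,k}`, `1 ≤ k ≤ n`. -/
def time (i : Fin p) (k : ℕ) : I := S.obs i (S.sel i k)

/-- All observation times of all assets. -/
def obsTimes : Set I := {t | ∃ i, ∃ l ≤ S.N i, t = S.obs i l}

/-- The number of `k ∈ {1, …, n}` with `τ_{i,k} = τ_{j,k}`. -/
def syncCount (i j : Fin p) : ℝ :=
  ∑ k ∈ Finset.Icc 1 n, Set.indicator {k : ℕ | S.time i k = S.time j k} (fun _ ↦ (1 : ℝ)) k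

/-- The mesh bound `τ_k - τ_{k-1} ≤ CΔ / n`. -/
def MeshBound (CΔ : ℝ) : Prop :=
  ∀ k ∈ Finset.Icc 1 n, (S.τ k : ℝ) - (S.τ (k - 1) : ℝ) ≤ CΔ / n

end SamplingScheme

/-! ### Stochastic processes on `[0, 1]` -/

section Processes

variable {Ω : Type} {mΩ : MeasurableSpace Ω}

/-- The usual conditions: right-continuity and completeness. -/
def UsualConditions (P : Measure Ω) (𝓕 : Filtration I mΩ) : Prop :=
  𝓕.IsRightContinuous ∧ ∀ A : Set Ω, P A = 0 → MeasurableSet[𝓕 0] A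

/-- A `q`-dimensional standard Brownian motion on `[0, 1]` relative to the filtration `𝓕`. -/
structure IsBrownianMotion (P : Measure Ω) (𝓕 : Filtration I mΩ) {q : ℕ}
    (W : Fin q → I → Ω → ℝ) : Prop where
  adapted : ∀ l, StronglyAdapted 𝓕 (W l)
  start : ∀ l, ∀ᵐ ω ∂P, W l 0 ω = 0
  cont : ∀ l, ∀ᵐ ω ∂P, Continuous fun t ↦ W l t ω
  law : ∀ s t : I, s ≤ t → HasLaw (fun ω l ↦ W l t ω - W l s ω)
    (Measure.pi fun _ : Fin q ↦ gaussianReal 0 (Real.toNNReal ((t : ℝ) - s))) P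
  indep : ∀ s t : I, s ≤ t →
    Indep (MeasurableSpace.comap (fun ω l ↦ W l t ω - W l s ω) inferInstance) (𝓕 s) P

/-- A `p`-dimensional (inhomogeneous) Poisson process on `[0, 1]` relative to the filtration `𝓕`
whose `i`-th component has the intensity function `lam i`. -/
structure IsPoissonProcess (P : Measure Ω) (𝓕 : Filtration I mΩ) {p : ℕ}
    (lam : Fin p → I → ℝ) (Λ : Fin p → I → Ω → ℕ) : Prop where
  adapted : ∀ i, StronglyAdapted 𝓕 (Λ i)
  start : ∀ i, ∀ᵐ ω ∂P, Λ i 0 ω = 0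
  mono : ∀ i, ∀ᵐ ω ∂P, Monotone fun t ↦ Λ i t ω
  right_cont : ∀ i, ∀ᵐ ω ∂P, ∀ t, ContinuousWithinAt (fun s ↦ Λ i s ω) (Set.Ici t) t
  law : ∀ i, ∀ s t : I, s ≤ t → HasLaw (fun ω ↦ Λ i t ω - Λ i s ω)
    (poissonMeasure (Real.toNNReal (∫ u in Set.Ioc s t, lam i u))) P
  indep : ∀ s t : I, s ≤ t →
    Indep (MeasurableSpace.comap (fun ω i ↦ Λ i t ω - Λ i s ω) inferInstance) (𝓕 s) P

/-- A bounded simple predictable integrand `∑_{r < m} ξ_r 1_{(t_r, t_{r+1}]}` with `ξ_r` bounded and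
`𝓕_{t_r}`-measurable. -/
structure SimpleIntegrand (𝓕 : Filtration I mΩ) where
  m : ℕ
  t : ℕ → I
  t_mono : Monotone t
  ξ : ℕ → Ω → ℝ
  ξ_meas : ∀ r, Measurable[𝓕 (t r)] (ξ r)
  ξ_bdd : ∃ B, ∀ r ω, |ξ r ω| ≤ B

namespace SimpleIntegrand

variable {𝓕 : Filtration I mΩ} (H : SimpleIntegrand 𝓕)

/-- The value of the simple integrand at time `s`. -/
def val (s : I) (ω : Ω) : ℝ :=
  ∑ r ∈ Finset.range H.m, Set.indicator (Set.Ioc (H.t r) (H.t (r + 1))) (fun _ ↦ H.ξ r ω) s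

/-- The elementary stochastic integral `∫_0^u H dW`. -/
def integral (W : I → Ω → ℝ) (u : I) (ω : Ω) : ℝ :=
  ∑ r ∈ Finset.range H.m, H.ξ r ω * (W (min (H.t (r + 1)) u) ω - W (min (H.t r) u) ω)

end SimpleIntegrand

/-- `M` is (a version of) the Itô integral `M_t = ∫_0^t H dW`: the integrand is the
`L²(P ⊗ dt)`-limit of simple integrands whose elementary integrals converge to `M_t` in `L²(P)`. -/
def IsItoIntegral (P : Measure Ω) (𝓕 : Filtration I mΩ) (W H M : I → Ω → ℝ) : Prop :=
  ∃ Hn : ℕ → SimpleIntegrand 𝓕,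
    Tendsto (fun n ↦ ∫⁻ ω, ∫⁻ s : I, ‖(Hn n).val s ω - H s ω‖ₑ ^ 2 ∂volume ∂P) atTop (𝓝 0) ∧
    ∀ t, Tendsto (fun n ↦ ∫⁻ ω, ‖(Hn n).integral W t ω - M t ω‖ₑ ^ 2 ∂P) atTop (𝓝 0)

/-- The pathwise integral `∫_0^t L dΛ = ∑_{r=1}^{Λ(t)} L(T_r)` of `L` against a counting process
`Λ`, where `T_r = inf {s : Λ(s) ≥ r}` is the time of the `r`-th jump. -/
def jumpIntegral (L : I → Ω → ℝ) (Λ : I → Ω → ℕ) (t : I) (ω : Ω) : ℝ :=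
  ∑ r ∈ Finset.Icc 1 (Λ t ω), L (sInf {s | r ≤ Λ s ω}) ω

/-- The jump-diffusion model `dX = dXᶜ + L dΛ = μ dt + σᵀ dW + L dΛ`, `Xᶜ(0) = X(0)`, for the
log-prices of `p` assets (`vol` is the `q × p` matrix `σ`, `lam` the intensity of `Λ`) on a filtered probability space satisfying the usual conditions. -/
structure JumpDiffusion (P : Measure Ω) (p : ℕ) where
  𝓕 : Filtration I mΩ
  usual : UsualConditions P 𝓕
  q : ℕ
  W : Fin q → I → Ω → ℝ
  isBM : IsBrownianMotion P 𝓕 W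
  μ : Fin p → I → Ω → ℝ
  μ_prog : ∀ i, IsStronglyProgressive 𝓕 (μ i)
  vol : Fin q → Fin p → I → Ω → ℝ
  vol_prog : ∀ l i, IsStronglyProgressive 𝓕 (vol l i)
  lam : Fin p → I → ℝ
  lam_meas : ∀ i, Measurable (lam i)
  lam_nonneg : ∀ i t, 0 ≤ lam i t
  Λ : Fin p → I → Ω → ℕ
  isPoisson : IsPoissonProcess P 𝓕 lam Λ
  L : Fin p → I → Ω → ℝ
  L_prog : ∀ i, IsStronglyProgressive 𝓕 (L i)
  Xc : Fin p → I → Ω → ℝ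
  Xc_adapted : ∀ i, StronglyAdapted 𝓕 (Xc i)
  Xc_cont : ∀ i, ∀ᵐ ω ∂P, Continuous fun t ↦ Xc i t ω
  X : Fin p → I → Ω → ℝ
  X_adapted : ∀ i, StronglyAdapted 𝓕 (X i)
  /-- `Xᶜ_i(t) = X_i(0) + ∫_0^t μ_i ds + ∑_l ∫_0^t σ_{li} dW_l`. -/
  Xc_eq : ∃ M : Fin q → Fin p → I → Ω → ℝ,
    (∀ l i, IsItoIntegral P 𝓕 (W l) (vol l i) (M l i)) ∧
    ∀ i t, ∀ᵐ ω ∂P,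
      Xc i t ω = X i 0 ω + (∫ s in Set.Ioc 0 t, μ i s ω) + ∑ l, M l i t ω
  X_eq : ∀ i, ∀ᵐ ω ∂P, ∀ t, X i t ω = Xc i t ω + jumpIntegral (L i) (Λ i) t ω

/-- The instantaneous volatility matrix `γ = σᵀ σ`. -/
def JumpDiffusion.γ {P : Measure Ω} {p : ℕ} (D : JumpDiffusion P p) (i j : Fin p) (t : I) (ω : Ω) :
    ℝ := ∑ l, D.vol l i t ω * D.vol l j t ω

/-- Microstructural noise at the observation times: the noise vectors at distinct times are
independent, each component has mean zero and is identically distributed over time, and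
`E[ε_i(t) ε_j(t)] = η_ij`. -/
structure Noise (P : Measure Ω) {p n : ℕ} (S : SamplingScheme p n) where
  ε : Fin p → I → Ω → ℝ
  η : Fin p → Fin p → ℝ
  meas : ∀ i, ∀ t ∈ S.obsTimes, Measurable (ε i t)
  indep : iIndepFun (fun (t : S.obsTimes) ω (i : Fin p) ↦ ε i t ω) P
  ident : ∀ i, ∀ s ∈ S.obsTimes, ∀ t ∈ S.obsTimes, IdentDistrib (ε i s) (ε i t) P P
  integrable : ∀ i, ∀ t ∈ S.obsTimes, Integrable (ε i t) P
  mean : ∀ i, ∀ t ∈ S.obsTimes, ∫ ω, ε i t ω ∂P = 0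
  integrable_mul : ∀ i j, ∀ t ∈ S.obsTimes, Integrable (fun ω ↦ ε i t ω * ε j t ω) P
  cov : ∀ i j, ∀ t ∈ S.obsTimes, ∫ ω, ε i t ω * ε j t ω ∂P = η i j

end Processes

/-! ### The observation model -/

/-- A jump-diffusion observed with independent microstructural noise at the times of `S`. -/
structure Model {p n : ℕ} (S : SamplingScheme p n) where
  Ω : Type
  mΩ : MeasurableSpace Ω
  P : Measure Ω
  prob : IsProbabilityMeasure P
  price : JumpDiffusion P p
  noise : Noise P S
  indep : IndepFun
    (fun ω (u : Fin p × I) ↦ (price.X u.1 u.2 ω, price.Xc u.1 u.2 ω))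
    (fun ω (u : Fin p × S.obsTimes) ↦ noise.ε u.1 u.2 ω) P

namespace Model

variable {p n : ℕ} {S : SamplingScheme p n} (M : Model S)

/-- The observed log-price `Y_i(τ_{i,k})`. -/
def Y (i : Fin p) (k : ℕ) (ω : M.Ω) : ℝ :=
  M.price.X i (S.time i k) ω + M.noise.ε i (S.time i k) ω

/-- The continuous part `Yᶜ_i(τ_{i,k})` of the observed log-price. -/
def Yc (i : Fin p) (k : ℕ) (ω : M.Ω) : ℝ :=
  M.price.Xc i (S.time i k) ω + M.noise.ε i (S.time i k) ω

/-- The quadratic log-returns `Q_{ρ,ij}(τ_k)`, `1 ≤ k ≤ n - 1`. -/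
def Qρ (i j : Fin p) (k : ℕ) (ω : M.Ω) : ℝ :=
  1 / 2 * (M.Y i (k + 1) ω - M.Y i k ω) * (M.Y j (k + 1) ω - M.Y j k ω)

/-- The continuous part `Qᶜ_{ρ,ij}(τ_k)`, `1 ≤ k ≤ n - 1`. -/
def Qρc (i j : Fin p) (k : ℕ) (ω : M.Ω) : ℝ :=
  1 / 2 * (M.Yc i (k + 1) ω - M.Yc i k ω) * (M.Yc j (k + 1) ω - M.Yc j k ω)

/-- The pre-averaged data `Zᶜ_i(τ_k)`, `1 ≤ k ≤ n - K`. -/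
def Zc (g : ℝ → ℝ) (K : ℕ) (i : Fin p) (k : ℕ) (ω : M.Ω) : ℝ :=
  ∑ l ∈ Finset.range K, g ((l : ℝ) / K) * (M.Yc i (k + l + 1) ω - M.Yc i (k + l) ω)

/-- The quadratic pre-averaged variables `Qᶜ_{ij}(τ_k)`, `1 ≤ k ≤ n - K`. -/
def Qc (g : ℝ → ℝ) (K : ℕ) (i j : Fin p) (k : ℕ) (ω : M.Ω) : ℝ :=
  ((n : ℝ) - K) / (phi g K * K) * M.Zc g K i k ω * M.Zc g K j k ω

/-- The parameter `ρ_ij = (φ K)⁻¹ ∑_{k=1}^n 1(τ_{i,k} = τ_{j,k}) ζ η_ij`. -/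
def ρ (g : ℝ → ℝ) (K : ℕ) (i j : Fin p) : ℝ :=
  S.syncCount i j / (phi g K * K) * zeta g K * M.noise.η i j

/-- Boundedness of the drift, the volatility and the jump intensity. -/
def BoundedCoeff (νμ νγ νI : ℝ) : Prop :=
  (∀ᵐ ω ∂M.P, ∀ i t, |M.price.μ i t ω| ≤ νμ) ∧
  (∀ᵐ ω ∂M.P, ∀ i t, M.price.γ i i t ω ≤ νγ) ∧
  ∀ i t, M.price.lam i t ≤ νI

/-- `max_i E|Qᶜ_ii(τ_k)|^{α_i} ≤ νQ` for `1 ≤ k ≤ n - K`. -/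
def MomentQ (g : ℝ → ℝ) (K : ℕ) (α : Fin p → ℝ) (νQ : ℝ) : Prop :=
  ∀ i, ∀ k, 1 ≤ k → k + K ≤ n →
    Integrable (fun ω ↦ |M.Qc g K i i k ω| ^ α i) M.P ∧
    ∫ ω, |M.Qc g K i i k ω| ^ α i ∂M.P ≤ νQ

/-- The class `Ξ_ρ(α_1, …, α_p)`: `max_i E|Qᶜ_{ρ,ii}(τ_k)|^{α_i} ≤ νρ` for `1 ≤ k ≤ n - 1`. -/
def MomentQρ (α : Fin p → ℝ) (νρ : ℝ) : Prop :=
  ∀ i, ∀ k, 1 ≤ k → k + 1 ≤ n →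
    Integrable (fun ω ↦ |M.Qρc i i k ω| ^ α i) M.P ∧
    ∫ ω, |M.Qρc i i k ω| ^ α i ∂M.P ≤ νρ

/-- The data `(Q_{ρ,ij}(τ_1), …, Q_{ρ,ij}(τ_{n-1}))` available to an estimator of `ρ_ij`. -/
def data (i j : Fin p) (ω : M.Ω) : Fin (n - 1) → ℝ := fun k ↦ M.Qρ i j (k + 1) ω

end Model

end RobustVol

end

/-! The proof is a two-point argument in which both models have identically zero prices. At each
observation time the noise of asset `h` is `m h` times a variable equal to `0` with probability `1 -
w` and to `1` or `-1` with probability `w / 2` each. All assets share this variable, so that `η_ij =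
m i * m j * w`. The competing model has `m = 0`.

With `w = log δ⁻¹ / (4n)` and at most `2n` observation times, all noise variables vanish together
with probability at least `δ`. On that event the data are zero in both models, so the estimator
returns the same number. That number cannot be within `r` of both `0` and `ρ_ij ≥ 2r`
(`two_point_lower_bound`).

It remains to make `η_ij` large within the class. Both moment conditions reduce to `m h ^ (2α_h) *
w` being small (`noiseModel_momentQρ`, `noiseModel_momentQ`), so `m i = (κ/w)^(1/(2α_i))` is
admissible for small `κ`. Then `η_ij` has order `w^(1 - 1/α_ij)` because `α_ij` is the harmonic mean
of `α_i` and `α_j` (`scale_mul_scale`). As `K` has order `√n`, and `K ζ` and `φ` are bounded below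
and above respectively (`IsWeight.exists_bounds`), `ρ_ij` is at least a constant times `η_ij`.

The delicate condition is the one on `Qᶜ`. After summation by parts `|Zᶜ|` is at most a multiple of
`|m| N / K`, where `N` counts the nonzero noises among `K` times. Since `log δ⁻¹ ≤ √n`, the product
`K w` stays bounded, and exponential moments give `E N^(2α)` of order `K w`. -/

noncomputable section

namespace RobustVol

/-! ### Weight functions -/

/-- A function with a Lipschitz derivative on a bounded open interval, continuous up to the end
points, is Lipschitz. -/
lemma exists_lipschitz_of_lipschitz_deriv {g g' : ℝ → ℝ} {u v : ℝ} {L : ℝ≥0} (huv : u < v)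
    (hc : ContinuousOn g (Set.Icc u v)) (hL : LipschitzOnWith L g' (Set.Ioo u v))
    (hd : ∀ x ∈ Set.Ioo u v, HasDerivAt g (g' x) x) :
    ∃ B : ℝ, 0 ≤ B ∧ ∀ x ∈ Set.Icc u v, ∀ y ∈ Set.Icc u v, |g x - g y| ≤ B * |x - y| := by
  -- The midpoint is only an anchor: a Lipschitz `g'` on a bounded interval is bounded by its value
  -- there plus `L` times the length.
  set w := (u + v) / 2 with hw
  have hwm : w ∈ Set.Ioo u v := ⟨by rw [hw]; linarith, by rw [hw]; linarith⟩
  have hb : ∀ x ∈ Set.Ioo u v, |g' x| ≤ |g' w| + L * (v - u) := by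
    intro x hx
    have h1 := hL.dist_le_mul x hx w hwm
    rw [Real.dist_eq, Real.dist_eq] at h1
    have h2 : |x - w| ≤ v - u := by
      rw [abs_le]; constructor <;> linarith [hx.1, hx.2, hwm.1, hwm.2]
    have h3 : |g' x| ≤ |g' x - g' w| + |g' w| := by
      simpa using abs_add_le (g' x - g' w) (g' w)
    have h4 : (L : ℝ) * |x - w| ≤ L * (v - u) := by gcongr
    linarith
  refine ⟨|g' w| + L * (v - u), ?_, ?_⟩
  · have : 0 ≤ v - u := by linarith
    positivity
  have key : ∀ x ∈ Set.Icc u v, ∀ y ∈ Set.Icc u v, x < y →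
      |g x - g y| ≤ (|g' w| + L * (v - u)) * |x - y| := by
    intro x hx y hy hxy
    obtain ⟨c, hc1, hc2⟩ := exists_hasDerivAt_eq_slope g g' hxy
      (hc.mono (Set.Icc_subset_Icc hx.1 hy.2))
      (fun z hz ↦ hd z ⟨lt_of_le_of_lt hx.1 hz.1, lt_of_lt_of_le hz.2 hy.2⟩)
    have h0 : y - x ≠ 0 := by linarith
    rw [eq_div_iff h0] at hc2
    rw [abs_sub_comm, ← hc2, abs_mul, abs_sub_comm x y]
    gcongr
    exact hb c ⟨lt_of_le_of_lt hx.1 hc1.1, lt_of_lt_of_le hc1.2 hy.2⟩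
  intro x hx y hy
  rcases lt_trichotomy x y with h | h | h
  · exact key x hx y hy h
  · simp [h]
  · rw [abs_sub_comm, abs_sub_comm x]; exact key y hy x hx h

/-- Two adjacent Lipschitz pieces form a Lipschitz function. -/
lemma lipschitz_glue {g : ℝ → ℝ} {u v w B B' : ℝ} (hB : 0 ≤ B) (hB' : 0 ≤ B')
    (huv : u ≤ v) (hvw : v ≤ w)
    (h : ∀ x ∈ Set.Icc u v, ∀ y ∈ Set.Icc u v, |g x - g y| ≤ B * |x - y|)
    (h' : ∀ x ∈ Set.Icc v w, ∀ y ∈ Set.Icc v w, |g x - g y| ≤ B' * |x - y|) :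
    ∀ x ∈ Set.Icc u w, ∀ y ∈ Set.Icc u w, |g x - g y| ≤ (B + B') * |x - y| := by
  have mixed : ∀ x ∈ Set.Icc u v, ∀ y ∈ Set.Icc v w, |g x - g y| ≤ (B + B') * |x - y| := by
    intro x hx y hy
    have h1 := h x hx v ⟨huv, le_rfl⟩
    have h2 := h' v ⟨le_rfl, hvw⟩ y hy
    have e1 : |x - v| ≤ |x - y| := by
      rw [abs_of_nonpos (by linarith [hx.2]), abs_of_nonpos (by linarith [hx.2, hy.1])]
      linarith [hy.1]
    have e2 : |v - y| ≤ |x - y| := by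
      rw [abs_of_nonpos (by linarith [hy.1]), abs_of_nonpos (by linarith [hx.2, hy.1])]
      linarith [hx.2]
    have := abs_sub_le (g x) (g v) (g y)
    have e3 := mul_le_mul_of_nonneg_left e1 hB
    have e4 := mul_le_mul_of_nonneg_left e2 hB'
    linarith
  intro x hx y hy
  have m1 : B * |x - y| ≤ (B + B') * |x - y| := by gcongr; linarith
  have m2 : B' * |x - y| ≤ (B + B') * |x - y| := by gcongr; linarith
  rcases le_total x v with h1 | h1 <;> rcases le_total y v with h2 | h2
  · exact (h x ⟨hx.1, h1⟩ y ⟨hy.1, h2⟩).trans m1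
  · exact mixed x ⟨hx.1, h1⟩ y ⟨h2, hy.2⟩
  · rw [abs_sub_comm, abs_sub_comm x]
    exact mixed y ⟨hy.1, h2⟩ x ⟨h1, hx.2⟩
  · exact (h' x ⟨h1, hx.2⟩ y ⟨h2, hy.2⟩).trans m2

/-- Each piece is Lipschitz up to its end points by continuity of `g`; the pieces are glued by
induction, adding the constants. -/
lemma IsWeight.exists_lipschitz {g : ℝ → ℝ} (hg : IsWeight g) :
    ∃ B : ℝ, 0 < B ∧
      ∀ x ∈ Set.Icc (0 : ℝ) 1, ∀ y ∈ Set.Icc (0 : ℝ) 1, |g x - g y| ≤ B * |x - y| := by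
  obtain ⟨m, s, hs0, hsm, hs⟩ := hg.piecewise
  have mono : ∀ r r', r ≤ r' → r' ≤ m → s r ≤ s r' := by
    intro r r' h
    induction r', h using Nat.le_induction with
    | base => intro _; exact le_rfl
    | succ k _ ih => intro hk; exact (ih (by omega)).trans (hs k (by omega)).1.le
  have key : ∀ r ≤ m, ∃ B : ℝ, 0 ≤ B ∧
      ∀ x ∈ Set.Icc 0 (s r), ∀ y ∈ Set.Icc 0 (s r), |g x - g y| ≤ B * |x - y| := by
    intro r
    induction r with
    | zero =>
      intro _
      refine ⟨0, le_rfl, fun x hx y hy ↦ ?_⟩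
      rw [hs0] at hx hy
      have hx' : x = 0 := le_antisymm hx.2 hx.1
      have hy' : y = 0 := le_antisymm hy.2 hy.1
      simp [hx', hy']
    | succ k ih =>
      intro hk
      obtain ⟨B, hB, h⟩ := ih (by omega)
      obtain ⟨hlt, g', L, hL, hd⟩ := hs k (by omega)
      have h0 : 0 ≤ s k := hs0 ▸ mono 0 k (by omega) (by omega)
      have h1 : s (k + 1) ≤ 1 := hsm ▸ mono (k + 1) m hk le_rfl
      obtain ⟨B', hB', h'⟩ := exists_lipschitz_of_lipschitz_deriv hlt
        (hg.cont.mono (Set.Icc_subset_Icc h0 h1)) hL hd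
      exact ⟨B + B', by positivity, lipschitz_glue hB hB' h0 hlt.le h h'⟩
  obtain ⟨B, hB, h⟩ := key m le_rfl
  rw [hsm] at h
  -- The added `1` makes the constant strictly positive.
  refine ⟨B + 1, by linarith, fun x hx y hy ↦ (h x hx y hy).trans ?_⟩
  gcongr
  linarith

section Lipschitz

variable {g : ℝ → ℝ} {B : ℝ}

lemma div_mem_unit {l K : ℕ} (h : l ≤ K) : (l : ℝ) / K ∈ Set.Icc (0 : ℝ) 1 :=
  ⟨by positivity, div_le_one_of_le₀ (by exact_mod_cast h) (by positivity)⟩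

lemma IsWeight.abs_le (hg : IsWeight g) (hB0 : 0 < B)
    (hB : ∀ x ∈ Set.Icc (0 : ℝ) 1, ∀ y ∈ Set.Icc (0 : ℝ) 1, |g x - g y| ≤ B * |x - y|)
    {x : ℝ} (hx : x ∈ Set.Icc (0 : ℝ) 1) : |g x| ≤ B := by
  have := hB x hx 0 ⟨le_rfl, zero_le_one⟩
  rw [hg.zero, sub_zero, sub_zero, abs_of_nonneg hx.1] at this
  nlinarith [hx.2]

lemma IsWeight.phi_le (hg : IsWeight g) (hB0 : 0 < B)
    (hB : ∀ x ∈ Set.Icc (0 : ℝ) 1, ∀ y ∈ Set.Icc (0 : ℝ) 1, |g x - g y| ≤ B * |x - y|)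
    {K : ℕ} (hK : 0 < K) : phi g K ≤ B ^ 2 := by
  have hK' : (0 : ℝ) < K := by exact_mod_cast hK
  have : ∑ l ∈ Finset.range K, g ((l : ℝ) / K) ^ 2 ≤ ∑ l ∈ Finset.range K, B ^ 2 := by
    refine Finset.sum_le_sum fun l hl ↦ ?_
    rw [← sq_abs]
    gcongr
    exact hg.abs_le hB0 hB (div_mem_unit (Finset.mem_range.1 hl).le)
  rw [Finset.sum_const, Finset.card_range, nsmul_eq_mul] at this
  rw [phi, one_div, inv_mul_le_iff₀ hK']
  exact this

lemma increment_le
    (hB : ∀ x ∈ Set.Icc (0 : ℝ) 1, ∀ y ∈ Set.Icc (0 : ℝ) 1, |g x - g y| ≤ B * |x - y|)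
    {K l : ℕ} (hl : l < K) : |g ((l : ℝ) / K) - g (((l : ℝ) + 1) / K)| ≤ B / K := by
  have hK : (0 : ℝ) < K := by exact_mod_cast (by omega : 0 < K)
  have h := hB _ (div_mem_unit hl.le) _ (div_mem_unit (show l + 1 ≤ K from hl))
  push_cast at h
  refine h.trans_eq ?_
  rw [← sub_div, abs_div, abs_of_pos hK]
  simp [div_eq_mul_inv]

/-- `phi g K` is the left Riemann sum of `g²`. On a cell of length `1/K`, factoring the difference
of squares bounds the deviation of `g²` from its left value by `(B/K) * 2B`. -/
lemma IsWeight.le_phi (hg : IsWeight g) (hB0 : 0 < B)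
    (hB : ∀ x ∈ Set.Icc (0 : ℝ) 1, ∀ y ∈ Set.Icc (0 : ℝ) 1, |g x - g y| ≤ B * |x - y|)
    {K : ℕ} (hK : 0 < K) : (∫ t in (0 : ℝ)..1, g t ^ 2) - 2 * B ^ 2 / K ≤ phi g K := by
  have hK' : (0 : ℝ) < K := by exact_mod_cast hK
  set u : ℕ → ℝ := fun l ↦ (l : ℝ) / K with hu
  have hu1 : ∀ l, u (l + 1) - u l = 1 / K := fun l ↦ by
    simp only [hu]; push_cast; rw [← sub_div]; congr 1; ring
  have hule : ∀ l, u l ≤ u (l + 1) := fun l ↦ by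
    have : (0 : ℝ) < 1 / K := by positivity
    linarith [hu1 l]
  have hcont : ∀ l < K, ContinuousOn (fun t ↦ g t ^ 2) (Set.uIcc (u l) (u (l + 1))) := by
    intro l hl
    rw [Set.uIcc_of_le (hule l)]
    exact (hg.cont.mono (Set.Icc_subset_Icc (div_mem_unit hl.le).1
      (div_mem_unit (show l + 1 ≤ K from hl)).2)).pow 2
  have hint : ∀ l < K, IntervalIntegrable (fun t ↦ g t ^ 2) volume (u l) (u (l + 1)) :=
    fun l hl ↦ (hcont l hl).intervalIntegrable
  have hsum := intervalIntegral.sum_integral_adjacent_intervals hint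
  have e0 : u 0 = 0 := by simp [hu]
  have e1 : u K = 1 := by simp [hu, hK'.ne']
  rw [e0, e1] at hsum
  rw [← hsum]
  have hle : ∀ l ∈ Finset.range K, ∫ t in (u l)..(u (l + 1)), g t ^ 2 ≤
      1 / K * (g (u l) ^ 2 + 2 * B ^ 2 / K) := by
    intro l hl
    have hl' := Finset.mem_range.1 hl
    have h1 : ∫ t in (u l)..(u (l + 1)), g t ^ 2 ≤
        ∫ t in (u l)..(u (l + 1)), (g (u l) ^ 2 + 2 * B ^ 2 / K) := by
      refine intervalIntegral.integral_mono_on (hule l) (hint l hl')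
        intervalIntegrable_const fun t ht ↦ ?_
      have ht1 : t ∈ Set.Icc (0 : ℝ) 1 := ⟨(div_mem_unit hl'.le).1.trans ht.1,
        ht.2.trans (div_mem_unit (show l + 1 ≤ K from hl')).2⟩
      have hul := div_mem_unit hl'.le
      have a1 := hg.abs_le hB0 hB ht1
      have a2 := hg.abs_le hB0 hB hul
      have a3 := hB t ht1 _ hul
      have a4 : |t - u l| ≤ 1 / K := by
        rw [abs_of_nonneg (by linarith [ht.1])]; linarith [ht.2, hu1 l]
      have a5 : |g t - g (u l)| ≤ B / K := by
        calc _ ≤ B * |t - u l| := a3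
          _ ≤ B * (1 / K) := by gcongr
          _ = B / K := mul_one_div _ _
      have a6 : |g t + g (u l)| ≤ 2 * B := by
        linarith [abs_add_le (g t) (g (u l))]
      have a7 : g t ^ 2 - g (u l) ^ 2 ≤ B / K * (2 * B) := by
        calc g t ^ 2 - g (u l) ^ 2 = (g t - g (u l)) * (g t + g (u l)) := by ring
          _ ≤ |(g t - g (u l)) * (g t + g (u l))| := le_abs_self _
          _ = |g t - g (u l)| * |g t + g (u l)| := abs_mul _ _
          _ ≤ _ := by gcongr
      have : B / K * (2 * B) = 2 * B ^ 2 / K := by ring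
      linarith
    rwa [intervalIntegral.integral_const, hu1, smul_eq_mul] at h1
  have := Finset.sum_le_sum hle
  rw [← Finset.mul_sum, Finset.sum_add_distrib, Finset.sum_const, Finset.card_range,
    nsmul_eq_mul, mul_add] at this
  have e : 1 / (K : ℝ) * (K * (2 * B ^ 2 / K)) = 2 * B ^ 2 / K := by field_simp
  rw [e] at this
  have : phi g K = 1 / (K : ℝ) * ∑ l ∈ Finset.range K, g (u l) ^ 2 := rfl
  linarith

lemma IsWeight.exists_ne_zero (hg : IsWeight g) : ∃ x ∈ Set.Icc (0 : ℝ) 1, g x ≠ 0 := by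
  by_contra! h
  have h0 := hg.sq_pos
  rw [intervalIntegral.integral_congr (g := fun _ ↦ (0 : ℝ))] at h0
  · simp at h0
  · intro x hx
    rw [Set.uIcc_of_le zero_le_one] at hx
    simp [h x hx]

/-- Since `g 0 = 0`, the value at `l/K` telescopes into `l ≤ K` increments, and Cauchy–Schwarz
applies. This keeps `K ζ` away from zero. -/
lemma IsWeight.sq_le_zeta (hg : IsWeight g) {K l : ℕ} (hl : l ≤ K) :
    g ((l : ℝ) / K) ^ 2 ≤ K * zeta g K := by
  have htel : ∑ r ∈ Finset.range l, (g ((r : ℝ) / K) - g (((r : ℝ) + 1) / K)) =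
      - g ((l : ℝ) / K) := by
    have := Finset.sum_range_sub' (fun r : ℕ ↦ g ((r : ℝ) / K)) l
    push_cast at this
    rw [this]; simp [hg.zero]
  have hcs := sq_sum_le_card_mul_sum_sq (s := Finset.range l)
    (f := fun r : ℕ ↦ g ((r : ℝ) / K) - g (((r : ℝ) + 1) / K))
  rw [htel, neg_sq, Finset.card_range] at hcs
  refine hcs.trans ?_
  have : ∑ r ∈ Finset.range l, (g ((r : ℝ) / K) - g (((r : ℝ) + 1) / K)) ^ 2 ≤ zeta g K :=
    Finset.sum_le_sum_of_subset_of_nonneg (Finset.range_mono hl) fun _ _ _ ↦ sq_nonneg _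
  have h0 : 0 ≤ ∑ r ∈ Finset.range l, (g ((r : ℝ) / K) - g (((r : ℝ) + 1) / K)) ^ 2 :=
    Finset.sum_nonneg fun _ _ ↦ sq_nonneg _
  gcongr

end Lipschitz

/-- Uniform bounds on `φ`, `ζ` and the increments of a weight function over fine grids. -/
lemma IsWeight.exists_bounds {g : ℝ → ℝ} (hg : IsWeight g) :
    ∃ B φ₀ ζ₀ : ℝ, 0 < B ∧ 0 < φ₀ ∧ 0 < ζ₀ ∧ ∃ K₀ : ℕ, 0 < K₀ ∧ ∀ K, K₀ ≤ K →
      φ₀ ≤ phi g K ∧ phi g K ≤ B ^ 2 ∧ ζ₀ ≤ K * zeta g K ∧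
      ∀ l < K, |g ((l : ℝ) / K) - g (((l : ℝ) + 1) / K)| ≤ B / K := by
  obtain ⟨B, hB0, hB⟩ := hg.exists_lipschitz
  obtain ⟨x, hx, hgx⟩ := hg.exists_ne_zero
  have hJ := hg.sq_pos
  set J := ∫ t in (0 : ℝ)..1, g t ^ 2
  have hax : 0 < |g x| := abs_pos.2 hgx
  refine ⟨B, J / 2, (|g x| / 2) ^ 2, hB0, by positivity, by positivity,
    max (⌈4 * B ^ 2 / J⌉₊ + 1) (⌈2 * B / |g x|⌉₊ + 1), by positivity, fun K hK ↦ ?_⟩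
  have hKpos : 0 < K := by have := le_of_max_le_left hK; omega
  have hK' : (0 : ℝ) < K := by exact_mod_cast hKpos
  have k1 : 4 * B ^ 2 / J ≤ K := (Nat.le_ceil _).trans (by
    exact_mod_cast (Nat.le_succ _).trans (le_of_max_le_left hK))
  have k2 : 2 * B / |g x| ≤ K := (Nat.le_ceil _).trans (by
    exact_mod_cast (Nat.le_succ _).trans (le_of_max_le_right hK))
  refine ⟨?_, hg.phi_le hB0 hB hKpos, ?_, fun l hl ↦ increment_le hB hl⟩
  · have h := hg.le_phi hB0 hB hKpos
    rw [div_le_iff₀ hJ] at k1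
    have : 2 * B ^ 2 / K ≤ J / 2 := by
      rw [div_le_iff₀ hK']; linarith
    linarith
  -- The grid point just left of `x`, where `g x ≠ 0`: for `K ≥ 2B/|g x|` the weight there is still
  -- at least `|g x|/2` in absolute value.
  · have hl : ⌊x * K⌋₊ ≤ K := by
      apply Nat.floor_le_of_le
      nlinarith [hx.2]
    refine le_trans ?_ (hg.sq_le_zeta hl)
    rw [← sq_abs (g _)]
    gcongr
    have h1 := hB x hx _ (div_mem_unit hl)
    have h2 : |x - (⌊x * K⌋₊ : ℝ) / K| ≤ 1 / K := by
      have f1 := Nat.floor_le (mul_nonneg hx.1 hK'.le)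
      have f2 := Nat.lt_floor_add_one (x * K)
      have : x - (⌊x * K⌋₊ : ℝ) / K = (x * K - ⌊x * K⌋₊) / K := by field_simp
      rw [this, abs_of_nonneg (div_nonneg (by linarith) hK'.le)]
      gcongr
      linarith
    have h3 : B * |x - (⌊x * K⌋₊ : ℝ) / K| ≤ |g x| / 2 := by
      calc _ ≤ B * (1 / K) := by gcongr
        _ ≤ _ := by
          rw [div_le_iff₀ hax] at k2
          rw [mul_one_div, div_le_iff₀ hK']; linarith
    have h4 := abs_sub_abs_le_abs_sub (g x) (g ((⌊x * K⌋₊ : ℝ) / K))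
    linarith

/-! ### The price model without price movement -/

section TrivialPrice

variable {Ω : Type} [mΩ : MeasurableSpace Ω]

/-- The constant filtration. -/
def constFiltration (Ω : Type) [mΩ : MeasurableSpace Ω] : Filtration I mΩ where
  seq _ := mΩ
  mono' _ _ _ := le_rfl
  le' _ := le_rfl

lemma usualConditions_constFiltration [DiscreteMeasurableSpace Ω] (P : Measure Ω) :
    UsualConditions P (constFiltration Ω) :=
  ⟨⟨fun i ↦ (constFiltration Ω).rightCont.le i⟩, fun A _ ↦ @MeasurableSet.of_discrete Ω mΩ _ A⟩

/-- The dimension `q` is free, so `q = 0` spares any construction of Brownian motion: increments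
live in a one-point space, which carries a single probability measure. -/
lemma isBrownianMotion_zero_dim (P : Measure Ω) [IsProbabilityMeasure P] (𝓕 : Filtration I mΩ)
    (W : Fin 0 → I → Ω → ℝ) : IsBrownianMotion P 𝓕 W where
  adapted l := l.elim0
  start l := l.elim0
  cont l := l.elim0
  law s t _ := by
    have hm : AEMeasurable (fun ω (l : Fin 0) ↦ W l t ω - W l s ω) P :=
      aemeasurable_pi_lambda _ fun l ↦ l.elim0
    have : IsProbabilityMeasure (P.map fun ω (l : Fin 0) ↦ W l t ω - W l s ω) :=
      Measure.isProbabilityMeasure_map hm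
    refine ⟨hm, ?_⟩
    ext A _
    rcases Set.eq_empty_or_nonempty A with rfl | hA
    · simp
    · rw [Subsingleton.eq_univ_of_nonempty hA, measure_univ, measure_univ]
  indep s t _ := by
    have : (fun ω (l : Fin 0) ↦ W l t ω - W l s ω) = fun _ ↦ 0 := by
      ext ω l; exact l.elim0
    rw [this, MeasurableSpace.comap_const]
    exact indep_bot_left _

lemma poissonMeasure_zero : poissonMeasure 0 = Measure.dirac 0 := by
  refine Measure.ext_of_singleton fun k ↦ ?_
  rw [poissonMeasure_singleton]
  rcases k with _ | k <;> simp

lemma isPoissonProcess_zero (P : Measure Ω) [IsProbabilityMeasure P] (𝓕 : Filtration I mΩ)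
    (p : ℕ) : IsPoissonProcess P 𝓕 (fun (_ : Fin p) _ ↦ 0) (fun _ _ _ ↦ 0) where
  adapted _ _ := stronglyMeasurable_const
  start _ := by simp
  mono _ := ae_of_all _ fun _ ↦ monotone_const
  right_cont _ := ae_of_all _ fun _ _ ↦ continuousWithinAt_const
  law i s t _ := by
    refine ⟨by fun_prop, ?_⟩
    simp [poissonMeasure_zero]
  indep s t _ := by
    rw [MeasurableSpace.comap_const]
    exact indep_bot_left _

/-- Log-prices that are identically zero: no drift, no Brownian component and no jumps. -/
def zeroPrice [DiscreteMeasurableSpace Ω] (P : Measure Ω) [IsProbabilityMeasure P] (p : ℕ) :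
    JumpDiffusion P p where
  𝓕 := constFiltration Ω
  usual := usualConditions_constFiltration P
  q := 0
  W := fun _ _ _ ↦ 0
  isBM := isBrownianMotion_zero_dim P _ _
  μ := fun _ _ _ ↦ 0
  μ_prog _ := isStronglyProgressive_const _ _
  vol := fun _ _ _ _ ↦ 0
  vol_prog _ _ := isStronglyProgressive_const _ _
  lam := fun _ _ ↦ 0
  lam_meas _ := measurable_const
  lam_nonneg _ _ := le_rfl
  Λ := fun _ _ _ ↦ 0
  isPoisson := isPoissonProcess_zero P _ p
  L := fun _ _ _ ↦ 0
  L_prog _ := isStronglyProgressive_const _ _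
  Xc := fun _ _ _ ↦ 0
  Xc_adapted _ _ := stronglyMeasurable_const
  Xc_cont _ := ae_of_all _ fun _ ↦ continuous_const
  X := fun _ _ _ ↦ 0
  X_adapted _ _ := stronglyMeasurable_const
  Xc_eq := ⟨fun _ _ _ _ ↦ 0, fun l ↦ l.elim0, fun _ _ ↦ by simp⟩
  X_eq _ := by simp [jumpIntegral]

end TrivialPrice

/-! ### Three-point noise -/

/-- The values `0, 1, -1` of a three-point variable. -/
def sgn : Fin 3 → ℝ := ![0, 1, -1]

/-- The law on `Fin 3` with masses `1 - w, w / 2, w / 2`. -/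
def threePoint (w : ℝ) : Measure (Fin 3) :=
  ENNReal.ofReal (1 - w) • Measure.dirac 0 + ENNReal.ofReal (w / 2) • Measure.dirac 1 +
    ENNReal.ofReal (w / 2) • Measure.dirac 2

instance (w : ℝ) : IsFiniteMeasure (threePoint w) := by
  refine ⟨?_⟩
  simp [threePoint]

lemma isProbabilityMeasure_threePoint {w : ℝ} (h0 : 0 ≤ w) (h1 : w ≤ 1) :
    IsProbabilityMeasure (threePoint w) := by
  refine ⟨?_⟩
  simp only [threePoint, Measure.add_apply, Measure.smul_apply, measure_univ, smul_eq_mul, mul_one]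
  rw [← ENNReal.ofReal_add (by linarith) (by linarith),
    ← ENNReal.ofReal_add (by linarith) (by linarith)]
  rw [show 1 - w + w / 2 + w / 2 = 1 by ring, ENNReal.ofReal_one]

lemma integral_threePoint {w : ℝ} (h0 : 0 ≤ w) (h1 : w ≤ 1) (f : Fin 3 → ℝ) :
    ∫ x, f x ∂threePoint w = (1 - w) * f 0 + w / 2 * f 1 + w / 2 * f 2 := by
  have hi : ∀ (x : Fin 3) (r : ℝ), Integrable f (ENNReal.ofReal r • Measure.dirac x) :=
    fun _ _ ↦ Integrable.of_finite.smul_measure ENNReal.ofReal_ne_top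
  rw [threePoint, integral_add_measure, integral_add_measure, integral_smul_measure,
    integral_smul_measure, integral_smul_measure, integral_dirac, integral_dirac, integral_dirac,
    ENNReal.toReal_ofReal (by linarith), ENNReal.toReal_ofReal (by linarith)]
  · simp
  · exact hi _ _
  · exact hi _ _
  · exact (hi _ _).add_measure (hi _ _)
  · exact hi _ _

lemma threePoint_zero {w : ℝ} : threePoint w {0} = ENNReal.ofReal (1 - w) := by
  simp [threePoint]

section ThreePointNoise

variable {p n : ℕ} (S : SamplingScheme p n)

instance : Finite S.obsTimes := by
  have : S.obsTimes = ⋃ i, S.obs i '' Set.Iic (S.N i) := by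
    ext t
    simp only [SamplingScheme.obsTimes, Set.mem_ofPred_eq, Set.mem_iUnion, Set.mem_image,
      Set.mem_Iic]
    exact exists_congr fun i ↦ exists_congr fun l ↦ and_congr_right fun _ ↦ eq_comm
  rw [this]
  exact Set.toFinite _

instance : Fintype S.obsTimes := Fintype.ofFinite _

/-- Independent three-point variables, one for each observation time. -/
def noiseLaw (w : ℝ) : Measure (S.obsTimes → Fin 3) := Measure.pi fun _ ↦ threePoint w

variable {S}

lemma isProbabilityMeasure_noiseLaw {w : ℝ} (h0 : 0 ≤ w) (h1 : w ≤ 1) :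
    IsProbabilityMeasure (noiseLaw S w) := by
  have := isProbabilityMeasure_threePoint h0 h1
  unfold noiseLaw
  infer_instance

lemma measurePreserving_eval_noiseLaw {w : ℝ} (h0 : 0 ≤ w) (h1 : w ≤ 1) (t : S.obsTimes) :
    MeasurePreserving (Function.eval t) (noiseLaw S w) (threePoint w) := by
  have := isProbabilityMeasure_threePoint h0 h1
  exact measurePreserving_eval _ t

lemma integral_eval_noiseLaw {w : ℝ} (h0 : 0 ≤ w) (h1 : w ≤ 1) (t : S.obsTimes)
    (f : Fin 3 → ℝ) : ∫ ω, f (ω t) ∂noiseLaw S w = (1 - w) * f 0 + w / 2 * f 1 + w / 2 * f 2 := by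
  rw [← integral_threePoint h0 h1, ← (measurePreserving_eval_noiseLaw h0 h1 t).map_eq,
    integral_map (measurable_pi_apply t).aemeasurable Measurable.of_discrete.aestronglyMeasurable]

open Classical in
/-- The three-point noise of asset `h`, scaled by `m h`. All assets share the sign. -/
def noiseVar (m : Fin p → ℝ) (h : Fin p) (t : I) (ω : S.obsTimes → Fin 3) : ℝ :=
  if ht : t ∈ S.obsTimes then m h * sgn (ω ⟨t, ht⟩) else 0

lemma noiseVar_of_mem (m : Fin p → ℝ) (h : Fin p) {t : I} (ht : t ∈ S.obsTimes) :
    noiseVar (S := S) m h t = fun ω ↦ m h * sgn (ω ⟨t, ht⟩) := by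
  ext ω; simp [noiseVar, ht]

/-- The three-point noise as a microstructural noise. -/
def threePointNoise (m : Fin p → ℝ) {w : ℝ} (h0 : 0 ≤ w) (h1 : w ≤ 1) :
    Noise (noiseLaw S w) S where
  ε := noiseVar m
  η h h' := m h * m h' * w
  meas _ _ _ := Measurable.of_discrete
  indep := by
    have := isProbabilityMeasure_threePoint h0 h1
    have hind := iIndepFun_pi (μ := fun _ : S.obsTimes ↦ threePoint w)
      (X := fun (_ : S.obsTimes) (x : Fin 3) (h : Fin p) ↦ m h * sgn x)
      (fun _ ↦ Measurable.of_discrete.aemeasurable)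
    have he : (fun (t : S.obsTimes) (ω : S.obsTimes → Fin 3) (h : Fin p) ↦ noiseVar m h t ω) =
        fun t ω h ↦ m h * sgn (ω t) := by
      ext t ω h
      rw [noiseVar_of_mem m h t.2]
    rw [he]
    exact hind
  ident h s hs t ht := by
    rw [noiseVar_of_mem m h hs, noiseVar_of_mem m h ht]
    have hst : IdentDistrib (fun ω : S.obsTimes → Fin 3 ↦ ω ⟨s, hs⟩) (fun ω ↦ ω ⟨t, ht⟩)
        (noiseLaw S w) (noiseLaw S w) :=
      ⟨(measurable_pi_apply _).aemeasurable, (measurable_pi_apply _).aemeasurable,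
        (measurePreserving_eval_noiseLaw h0 h1 ⟨s, hs⟩).map_eq.trans
          (measurePreserving_eval_noiseLaw h0 h1 ⟨t, ht⟩).map_eq.symm⟩
    exact hst.comp (u := fun x ↦ m h * sgn x) Measurable.of_discrete
  integrable _ _ _ := by
    have := isProbabilityMeasure_noiseLaw (S := S) h0 h1
    exact Integrable.of_finite
  mean h t ht := by
    rw [noiseVar_of_mem m h ht]
    rw [integral_eval_noiseLaw h0 h1 ⟨t, ht⟩ (fun x ↦ m h * sgn x)]
    simp [sgn]
  integrable_mul _ _ _ _ := by
    have := isProbabilityMeasure_noiseLaw (S := S) h0 h1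
    exact Integrable.of_finite
  cov h h' t ht := by
    rw [noiseVar_of_mem m h ht, noiseVar_of_mem m h' ht]
    rw [integral_eval_noiseLaw h0 h1 ⟨t, ht⟩ (fun x ↦ m h * sgn x * (m h' * sgn x))]
    simp [sgn]
    ring

/-- Constant prices observed with three-point noise. -/
def noiseModel (S : SamplingScheme p n) (m : Fin p → ℝ) {w : ℝ} (h0 : 0 ≤ w) (h1 : w ≤ 1) :
    Model S where
  Ω := S.obsTimes → Fin 3
  mΩ := inferInstance
  P := noiseLaw S w
  prob := isProbabilityMeasure_noiseLaw h0 h1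
  price := @zeroPrice _ _ _ (noiseLaw S w) (isProbabilityMeasure_noiseLaw h0 h1) p
  noise := threePointNoise m h0 h1
  indep := by
    have := isProbabilityMeasure_noiseLaw (S := S) h0 h1
    exact indepFun_const_left (fun _ : Fin p × I ↦ ((0 : ℝ), (0 : ℝ))) _

end ThreePointNoise

/-! ### Moments of three-point noise -/

lemma abs_sgn (x : Fin 3) : |sgn x| = if x = 0 then 0 else 1 := by
  fin_cases x <;> simp [sgn]

/-- The sum counts the nonzero noises, so it is a natural number. The gap between `0` and `1` is
what allows powers to be compared with `exp x - 1`. -/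
lemma sum_abs_sgn_eq_zero_or_one_le {κ : Type} (s : Finset κ) (f : κ → Fin 3) :
    ∑ l ∈ s, |sgn (f l)| = 0 ∨ 1 ≤ ∑ l ∈ s, |sgn (f l)| := by
  simp only [abs_sgn]
  rw [Finset.sum_ite, Finset.sum_const_zero, zero_add, Finset.sum_const, nsmul_eq_mul, mul_one]
  rcases Nat.eq_zero_or_pos (Finset.card {x ∈ s | ¬f x = 0}) with h | h
  · left; exact_mod_cast h
  · right; exact_mod_cast h

/-- Powers are dominated by `exp x - 1` on `{0} ∪ [1, ∞)`. -/
lemma exists_rpow_le_exp_sub_one {r : ℝ} (hr : 0 < r) :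
    ∃ C : ℝ, 0 < C ∧ ∀ x : ℝ, x = 0 ∨ 1 ≤ x → x ^ r ≤ C * (Real.exp x - 1) := by
  refine ⟨2 * (Nat.factorial ⌈r⌉₊ : ℝ), by positivity, ?_⟩
  rintro x (rfl | hx)
  · simp [Real.zero_rpow hr.ne']
  have hf : (0 : ℝ) < Nat.factorial ⌈r⌉₊ := by positivity
  -- For `x ≥ 1` the exponent may be rounded up and compared with one term of the exponential
  -- series; the factor `2` is paid for `exp x ≤ 2 (exp x - 1)`.
  have h1 : x ^ r ≤ x ^ ⌈r⌉₊ := by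
    rw [← Real.rpow_natCast]
    exact Real.rpow_le_rpow_of_exponent_le hx (Nat.le_ceil r)
  have h2 := Real.pow_div_factorial_le_exp x (by linarith) ⌈r⌉₊
  rw [div_le_iff₀ hf] at h2
  have h3 : 2 ≤ Real.exp x := by linarith [Real.add_one_le_exp x]
  nlinarith

section Moments

variable {p n : ℕ} {S : SamplingScheme p n} {w : ℝ} {κ : Type} [Fintype κ]

lemma integral_exp_sum_abs_sgn (h0 : 0 ≤ w) (h1 : w ≤ 1) {t : κ → S.obsTimes}
    (ht : Function.Injective t) :
    ∫ ω, Real.exp (∑ l, |sgn (ω (t l))|) ∂noiseLaw S w =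
      (1 + w * (Real.exp 1 - 1)) ^ Fintype.card κ := by
  have := isProbabilityMeasure_threePoint h0 h1
  have hind := (iIndepFun_pi (μ := fun _ : S.obsTimes ↦ threePoint w)
      (X := fun (_ : S.obsTimes) (x : Fin 3) ↦ Real.exp |sgn x|)
      (fun _ ↦ Measurable.of_discrete.aemeasurable)).precomp ht
  have hprod := hind.integral_fun_prod_eq_prod_integral
    (fun _ ↦ Measurable.of_discrete.aestronglyMeasurable)
  simp_rw [Real.exp_sum]
  refine hprod.trans ?_
  rw [← Finset.card_univ]
  refine Finset.prod_eq_pow_card fun l _ ↦ ?_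
  refine (integral_eval_noiseLaw h0 h1 (t l) fun x ↦ Real.exp |sgn x|).trans ?_
  simp [sgn]
  ring

/-- With `y = 2 K w`, the product formula is at most `exp y`, and `exp y - 1 ≤ y exp y`. The point
is linearity in `K w`: subtracting `1` removes the event without noise. -/
lemma integral_exp_sum_abs_sgn_sub_one_le (h0 : 0 ≤ w) (h1 : w ≤ 1) {t : κ → S.obsTimes}
    (ht : Function.Injective t) {D : ℝ} (hD : Fintype.card κ * w ≤ D) :
    ∫ ω, (Real.exp (∑ l, |sgn (ω (t l))|) - 1) ∂noiseLaw S w ≤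
      Fintype.card κ * w * (2 * Real.exp (2 * D)) := by
  have := isProbabilityMeasure_noiseLaw (S := S) h0 h1
  rw [integral_sub Integrable.of_finite Integrable.of_finite, integral_exp_sum_abs_sgn h0 h1 ht,
    integral_const, probReal_univ, one_smul]
  set K : ℝ := (Fintype.card κ : ℝ) with hK
  have hK0 : 0 ≤ K := by positivity
  have he : Real.exp 1 - 1 ≤ 2 := by linarith [Real.exp_one_lt_d9]
  have a1 : (1 + w * (Real.exp 1 - 1)) ^ Fintype.card κ ≤ Real.exp (2 * (K * w)) := by
    calc (1 + w * (Real.exp 1 - 1)) ^ Fintype.card κ ≤ (Real.exp (2 * w)) ^ Fintype.card κ := by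
          have : 0 ≤ Real.exp 1 - 1 := by linarith [Real.add_one_le_exp (1 : ℝ)]
          gcongr
          nlinarith [Real.add_one_le_exp (2 * w)]
      _ = Real.exp (2 * (K * w)) := by rw [← Real.exp_nat_mul]; congr 1; rw [← hK]; ring
  set y := 2 * (K * w)
  have hy : 0 ≤ y := by positivity
  have a2 : Real.exp y - 1 ≤ y * Real.exp y := by
    have h3 := Real.add_one_le_exp (-y)
    have h4 := Real.exp_pos y
    have h5 : Real.exp (-y) * Real.exp y = 1 := by rw [← Real.exp_add]; simp
    nlinarith
  have a3 : Real.exp y ≤ Real.exp (2 * D) := Real.exp_le_exp.2 (by simp only [y]; linarith)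
  calc _ ≤ y * Real.exp y := by linarith
    _ ≤ y * Real.exp (2 * D) := by gcongr
    _ = _ := by simp only [y]; ring

end Moments

/-! ### The noise model -/

lemma sum_mul_increment {G x : ℕ → ℝ} (K : ℕ) :
    ∑ l ∈ Finset.range K, G l * (x (l + 1) - x l) =
      ∑ l ∈ Finset.range K, (G l - G (l + 1)) * x (l + 1) + G K * x K - G 0 * x 0 := by
  induction K with
  | zero => simp
  | succ K ih => rw [Finset.sum_range_succ, Finset.sum_range_succ, ih]; ring

namespace SamplingScheme

variable {p n : ℕ} (S : SamplingScheme p n)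

lemma time_mem (i : Fin p) {k : ℕ} (hk : k ∈ Finset.Icc 1 n) : S.time i k ∈ S.obsTimes :=
  ⟨i, S.sel i k, S.sel_le i k hk, rfl⟩

lemma τ_mono {k l : ℕ} (hkl : k ≤ l) (hl : l ≤ n) : S.τ k ≤ S.τ l := by
  induction l, hkl using Nat.le_induction with
  | base => exact le_rfl
  | succ l _ ih => exact (ih (by omega)).trans (S.τ_lt l (by omega)).le

lemma time_lt (i : Fin p) {k l : ℕ} (hk : 1 ≤ k) (hkl : k < l) (hl : l ≤ n) :
    S.time i k < S.time i l :=
  ((S.sel_mem i k (Finset.mem_Icc.2 ⟨hk, by omega⟩)).2.trans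
    (S.τ_mono (by omega) (by omega))).trans_lt (S.sel_mem i l (Finset.mem_Icc.2 ⟨by omega, hl⟩)).1

lemma time_injOn (i : Fin p) : Set.InjOn (S.time i) (Set.Icc 1 n) := by
  intro k hk l hl h
  rcases lt_trichotomy k l with hkl | hkl | hkl
  · exact absurd h (S.time_lt i hk.1 hkl hl.2).ne
  · exact hkl
  · exact absurd h (S.time_lt i hl.1 hkl hk.2).ne'

end SamplingScheme

section NoiseModel

variable {p n : ℕ} {S : SamplingScheme p n} {m : Fin p → ℝ} {w : ℝ} {h0 : 0 ≤ w} {h1 : w ≤ 1}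

lemma noiseModel_boundedCoeff {νμ νγ νI : ℝ} (hμ : 0 ≤ νμ) (hγ : 0 ≤ νγ) (hI : 0 ≤ νI) :
    (noiseModel S m h0 h1).BoundedCoeff νμ νγ νI := by
  refine ⟨ae_of_all _ fun ω i t ↦ ?_, ae_of_all _ fun ω i t ↦ ?_, fun i t ↦ hI⟩
  · simpa [noiseModel, zeroPrice] using hμ
  · simpa [noiseModel, zeroPrice, JumpDiffusion.γ] using hγ

lemma noiseModel_Yc (i : Fin p) {k : ℕ} (hk : k ∈ Finset.Icc 1 n) (ω : S.obsTimes → Fin 3) :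
    (noiseModel S m h0 h1).Yc i k ω = m i * sgn (ω ⟨S.time i k, S.time_mem i hk⟩) := by
  have : (noiseModel S m h0 h1).Yc i k ω = 0 + noiseVar m i (S.time i k) ω := rfl
  rw [this, noiseVar_of_mem m i (S.time_mem i hk), zero_add]

/-- The quadratic return is `m²` times a quantity that is at most `2` and vanishes unless one of two
noises is nonzero; a union bound gives the factor `2 * w`. -/
lemma noiseModel_momentQρ {α : Fin p → ℝ} {ν : ℝ} (hν : 0 ≤ ν) (hα : ∀ h, 1 ≤ α h)
    (hm : ∀ h, m h = 0 ∨ (2 : ℝ) ^ α h * (m h ^ 2) ^ α h * (2 * w) ≤ ν) :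
    (noiseModel S m h0 h1).MomentQρ α ν := by
  have := isProbabilityMeasure_noiseLaw (S := S) h0 h1
  intro i k hk hkn
  refine ⟨Integrable.of_finite (μ := noiseLaw S w), ?_⟩
  have hk1 : k ∈ Finset.Icc 1 n := Finset.mem_Icc.2 ⟨hk, by omega⟩
  have hk2 : k + 1 ∈ Finset.Icc 1 n := Finset.mem_Icc.2 ⟨by omega, hkn⟩
  set t : S.obsTimes := ⟨S.time i k, S.time_mem i hk1⟩
  set t' : S.obsTimes := ⟨S.time i (k + 1), S.time_mem i hk2⟩
  have hα0 : 0 < α i := by linarith [hα i]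
  have hQ : ∀ ω : S.obsTimes → Fin 3, (noiseModel S m h0 h1).Qρc i i k ω =
      m i ^ 2 * (1 / 2 * (sgn (ω t') - sgn (ω t)) ^ 2) := by
    intro ω
    have hdef : (noiseModel S m h0 h1).Qρc i i k ω = 1 / 2 *
        ((noiseModel S m h0 h1).Yc i (k + 1) ω - (noiseModel S m h0 h1).Yc i k ω) *
        ((noiseModel S m h0 h1).Yc i (k + 1) ω - (noiseModel S m h0 h1).Yc i k ω) := rfl
    rw [hdef, noiseModel_Yc i hk1, noiseModel_Yc i hk2]
    ring
  have hpt : ∀ x y : Fin 3, |1 / 2 * (sgn x - sgn y) ^ 2| ^ α i ≤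
      2 ^ α i * (|sgn x| + |sgn y|) := by
    intro x y
    by_cases hxy : x = 0 ∧ y = 0
    · obtain ⟨rfl, rfl⟩ := hxy
      simp [sgn, hα0.ne']
    · have b1 : |1 / 2 * (sgn x - sgn y) ^ 2| ≤ 2 := by
        fin_cases x <;> fin_cases y <;> norm_num [sgn]
      have b2 : 1 ≤ |sgn x| + |sgn y| := by
        rw [abs_sgn, abs_sgn]
        split_ifs <;> first | exact absurd ⟨‹_›, ‹_›⟩ hxy | norm_num
      calc |1 / 2 * (sgn x - sgn y) ^ 2| ^ α i ≤ 2 ^ α i := by gcongr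
        _ ≤ _ := le_mul_of_one_le_right (by positivity) b2
  have habs : ∀ s : S.obsTimes, ∫ ω, |sgn (ω s)| ∂noiseLaw S w = w := by
    intro s
    rw [integral_eval_noiseLaw h0 h1 s fun x ↦ |sgn x|]
    simp [sgn]
  have hle : ∫ ω, |(noiseModel S m h0 h1).Qρc i i k ω| ^ α i ∂noiseLaw S w ≤
      ∫ ω, (m i ^ 2) ^ α i * (2 ^ α i * (|sgn (ω t')| + |sgn (ω t)|)) ∂noiseLaw S w := by
    refine integral_mono (Integrable.of_finite) (Integrable.of_finite) fun ω ↦ ?_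
    simp only [hQ]
    rw [abs_mul, Real.mul_rpow (abs_nonneg _) (abs_nonneg _), abs_of_nonneg (sq_nonneg (m i))]
    gcongr
    exact hpt _ _
  refine hle.trans ?_
  rw [integral_const_mul, integral_const_mul, integral_add Integrable.of_finite
    Integrable.of_finite, habs, habs]
  rcases hm i with h | h
  · simpa [h, hα0.ne'] using hν
  · refine le_trans (le_of_eq ?_) h
    ring

/-- Summation by parts moves the differences onto the weights, whose increments are at most `B / K`;
the boundary terms vanish because `g 0 = g 1 = 0`. -/
lemma noiseModel_abs_Zc_le {g : ℝ → ℝ} (hg0 : g 0 = 0) (hg1 : g 1 = 0) {K : ℕ} {B : ℝ}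
    (hK : 0 < K) (hB : ∀ l < K, |g ((l : ℝ) / K) - g (((l : ℝ) + 1) / K)| ≤ B / K)
    (i : Fin p) {k : ℕ} (hk : 1 ≤ k) (hkn : k + K ≤ n) (ω : S.obsTimes → Fin 3) :
    |(noiseModel S m h0 h1).Zc g K i k ω| ≤ |m i| * (B / K) *
      ∑ l : Fin K, |sgn (ω ⟨S.time i (k + l + 1),
        S.time_mem i (Finset.mem_Icc.2 ⟨by omega, by omega⟩)⟩)| := by
  have hZ : (noiseModel S m h0 h1).Zc g K i k ω = ∑ l ∈ Finset.range K,
      (g ((l : ℝ) / K) - g (((l : ℝ) + 1) / K)) * (noiseModel S m h0 h1).Yc i (k + l + 1) ω := by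
    have := sum_mul_increment (G := fun l : ℕ ↦ g ((l : ℝ) / K))
      (x := fun l ↦ (noiseModel S m h0 h1).Yc i (k + l) ω) K
    have hK' : (K : ℝ) ≠ 0 := by positivity
    simp only [div_self hK', hg1, zero_mul, Nat.cast_zero, zero_div, hg0, add_zero, sub_zero,
      Nat.cast_add, Nat.cast_one] at this
    exact this
  rw [hZ, Finset.mul_sum, Finset.sum_range]
  refine (Finset.abs_sum_le_sum_abs _ _).trans (Finset.sum_le_sum fun l _ ↦ ?_)
  rw [noiseModel_Yc i (Finset.mem_Icc.2 ⟨by omega, by omega⟩), abs_mul, abs_mul,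
    mul_comm (|m i|) (B / K), mul_assoc]
  exact mul_le_mul_of_nonneg_right (hB l l.2) (mul_nonneg (abs_nonneg _) (abs_nonneg _))

/-- The moment bound for the pre-averaged variables: if `K w` is bounded, then so is
`E|Qᶜ|^α`, up to the factor `w m^{2α}`. -/
lemma noiseModel_momentQ {g : ℝ → ℝ} (hg0 : g 0 = 0) (hg1 : g 1 = 0) {K : ℕ} {B F D : ℝ}
    (hK : 0 < K) (hB : ∀ l < K, |g ((l : ℝ) / K) - g (((l : ℝ) + 1) / K)| ≤ B / K)
    (hF : (n : ℝ) ≤ F * K ^ 2 * phi g K) (hφ : 0 < phi g K) (hF0 : 0 ≤ F)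
    (hD : K * w ≤ D) {α : Fin p → ℝ} {ν : ℝ} (hν : 0 ≤ ν) (hα : ∀ h, 1 ≤ α h)
    (hm : ∀ h, m h = 0 ∨ ∃ C : ℝ, 0 ≤ C ∧
      (∀ x : ℝ, x = 0 ∨ 1 ≤ x → x ^ (2 * α h) ≤ C * (Real.exp x - 1)) ∧
      (F * B ^ 2) ^ α h * (m h ^ 2) ^ α h * w * (C * (2 * Real.exp (2 * D))) ≤ ν) :
    (noiseModel S m h0 h1).MomentQ g K α ν := by
  have := isProbabilityMeasure_noiseLaw (S := S) h0 h1
  intro i k hk hkn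
  refine ⟨Integrable.of_finite (μ := noiseLaw S w), ?_⟩
  have hα0 : 0 < α i := by linarith [hα i]
  have hK' : (0 : ℝ) < K := by exact_mod_cast hK
  have hK1 : (1 : ℝ) ≤ K := by exact_mod_cast hK
  set t : Fin K → S.obsTimes := fun l ↦ ⟨S.time i (k + l + 1),
        S.time_mem i (Finset.mem_Icc.2 ⟨by omega, by omega⟩)⟩ with ht
  have htinj : Function.Injective t := by
    intro l l' h
    have := S.time_injOn i ⟨by omega, by omega⟩ ⟨by omega, by omega⟩ (Subtype.ext_iff.1 h)
    exact Fin.ext (by omega)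
  set N : (S.obsTimes → Fin 3) → ℝ := fun ω ↦ ∑ l, |sgn (ω (t l))| with hN
  have hN0 : ∀ ω, 0 ≤ N ω := fun ω ↦ Finset.sum_nonneg fun _ _ ↦ abs_nonneg _
  have hQ : ∀ ω : S.obsTimes → Fin 3, |(noiseModel S m h0 h1).Qc g K i i k ω| ≤
      F * B ^ 2 * m i ^ 2 * (N ω ^ 2 / K) := by
    intro ω
    have hZ := noiseModel_abs_Zc_le (m := m) (h0 := h0) (h1 := h1) hg0 hg1 hK hB i hk hkn ω
    have hZ2 : |(noiseModel S m h0 h1).Zc g K i k ω| ^ 2 ≤ (|m i| * (B / K) * N ω) ^ 2 := by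
      gcongr
    have hkn' : ((k : ℝ) + K) ≤ n := by exact_mod_cast hkn
    have hc : |((n : ℝ) - K) / (phi g K * K)| ≤ F * K := by
      rw [abs_of_nonneg (div_nonneg (by have : (0 : ℝ) ≤ k := by positivity
                                        linarith) (by positivity)), div_le_iff₀ (by positivity)]
      nlinarith
    have hdef : (noiseModel S m h0 h1).Qc g K i i k ω = ((n : ℝ) - K) / (phi g K * K) *
        (noiseModel S m h0 h1).Zc g K i k ω * (noiseModel S m h0 h1).Zc g K i k ω := rfl
    rw [hdef, mul_assoc, abs_mul, abs_mul, ← sq]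
    calc _ ≤ F * K * (|m i| * (B / K) * N ω) ^ 2 := by gcongr
      _ = _ := by
        rw [mul_pow, mul_pow, sq_abs]
        field_simp
  rcases hm i with h | ⟨C, hC, hCx, h⟩
  · have : ∀ ω : S.obsTimes → Fin 3, (noiseModel S m h0 h1).Qc g K i i k ω = 0 := by
      intro ω
      have := hQ ω
      rw [h] at this
      simpa using this
    have hz : ∫ ω, |(noiseModel S m h0 h1).Qc g K i i k ω| ^ α i ∂noiseLaw S w = 0 := by
      simp [this, hα0.ne']
    exact hz.trans_le hν
  have hle : ∫ ω, |(noiseModel S m h0 h1).Qc g K i i k ω| ^ α i ∂noiseLaw S w ≤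
      ∫ ω, (F * B ^ 2) ^ α i * (m i ^ 2) ^ α i * (1 / K) * C * (Real.exp (N ω) - 1)
        ∂noiseLaw S w := by
    refine integral_mono (Integrable.of_finite) (Integrable.of_finite) fun ω ↦ ?_
    have e1 : (N ω ^ 2 / K) ^ α i ≤ 1 / K * (C * (Real.exp (N ω) - 1)) := by
      rw [Real.div_rpow (by positivity) hK'.le, div_eq_inv_mul, one_div]
      have e2 : (N ω ^ 2) ^ α i = N ω ^ (2 * α i) := by
        rw [← Real.rpow_natCast, ← Real.rpow_mul (hN0 ω)]; norm_num
      rw [e2]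
      -- Only `K ^ (-α) ≤ K⁻¹` is kept, which suffices to cancel the factor `K` in the expectation
      -- of `exp N - 1`.
      have e3 : (K : ℝ) ≤ (K : ℝ) ^ α i := by
        simpa using Real.rpow_le_rpow_of_exponent_le hK1 (hα i)
      have e4 := hCx (N ω) (sum_abs_sgn_eq_zero_or_one_le _ fun l ↦ ω (t l))
      have e5 : 0 ≤ N ω ^ (2 * α i) := Real.rpow_nonneg (hN0 ω) _
      gcongr
    calc |(noiseModel S m h0 h1).Qc g K i i k ω| ^ α i
        ≤ (F * B ^ 2 * m i ^ 2 * (N ω ^ 2 / K)) ^ α i := by gcongr; exact hQ ω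
      _ = (F * B ^ 2) ^ α i * (m i ^ 2) ^ α i * (N ω ^ 2 / K) ^ α i := by
        rw [Real.mul_rpow (by positivity) (by positivity),
          Real.mul_rpow (by positivity) (by positivity)]
      _ ≤ (F * B ^ 2) ^ α i * (m i ^ 2) ^ α i * (1 / K * (C * (Real.exp (N ω) - 1))) := by
        gcongr
      _ = _ := by ring
  refine hle.trans ?_
  rw [integral_const_mul]
  have hE := integral_exp_sum_abs_sgn_sub_one_le h0 h1 htinj (D := D) (by simpa using hD)
  rw [Fintype.card_fin] at hE
  calc _ ≤ (F * B ^ 2) ^ α i * (m i ^ 2) ^ α i * (1 / K) * C *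
        (K * w * (2 * Real.exp (2 * D))) := by gcongr
    _ = (F * B ^ 2) ^ α i * (m i ^ 2) ^ α i * w * (C * (2 * Real.exp (2 * D))) := by
      field_simp
    _ ≤ ν := h

end NoiseModel

/-! ### The uniform sampling scheme -/

/-- The grid points `k / n`, truncated to `[0, 1]`. -/
def grid (n k : ℕ) : I := Set.projIcc 0 1 zero_le_one ((k : ℝ) / n)

lemma coe_grid {n k : ℕ} (hk : k ≤ n) : (grid n k : ℝ) = (k : ℝ) / n := by
  rw [grid, Set.projIcc_of_mem zero_le_one (div_mem_unit hk)]

lemma grid_lt {n k l : ℕ} (hkl : k < l) (hl : l ≤ n) : grid n k < grid n l := by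
  rw [← Subtype.coe_lt_coe, coe_grid hl, coe_grid (by omega)]
  have : (0 : ℝ) < n := by exact_mod_cast (by omega : 0 < n)
  gcongr

/-- All assets are observed at the times `0, 1/n, …, 1`. -/
def uniformScheme (p : ℕ) {n : ℕ} (hn : 0 < n) : SamplingScheme p n where
  τ := grid n
  τ_zero := by apply Subtype.ext; rw [coe_grid (Nat.zero_le n)]; simp
  τ_last := by
    have : (n : ℝ) ≠ 0 := by positivity
    apply Subtype.ext; rw [coe_grid le_rfl]; simp [this]
  τ_lt k hk := grid_lt (Nat.lt_succ_self k) hk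
  N _ := n
  obs _ := grid n
  obs_strictMono _ _ _ _ hl hkl := grid_lt hkl hl
  sel _ k := k
  sel_le _ k hk := (Finset.mem_Icc.1 hk).2
  sel_mem _ k hk := by
    have := Finset.mem_Icc.1 hk
    exact ⟨grid_lt (by omega) this.2, le_rfl⟩

lemma uniformScheme_meshBound {p n : ℕ} (hn : 0 < n) {CΔ : ℝ} (hC : 1 ≤ CΔ) :
    (uniformScheme p hn).MeshBound CΔ := by
  intro k hk
  have hk' := Finset.mem_Icc.1 hk
  have h0 : (0 : ℝ) < n := by exact_mod_cast hn
  change (grid n k : ℝ) - grid n (k - 1) ≤ CΔ / n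
  rw [coe_grid hk'.2, coe_grid (by omega), Nat.cast_sub hk'.1, ← sub_div]
  gcongr
  push_cast
  linarith

lemma uniformScheme_syncCount {p n : ℕ} (hn : 0 < n) (i j : Fin p) :
    (uniformScheme p hn).syncCount i j = n := by
  simp [SamplingScheme.syncCount, SamplingScheme.time, uniformScheme]

lemma card_obsTimes_uniformScheme_le {p n : ℕ} (hn : 0 < n) :
    Fintype.card (uniformScheme p hn).obsTimes ≤ n + 1 := by
  have hsub : (uniformScheme p hn).obsTimes ⊆ grid n '' Finset.range (n + 1) := by
    rintro t ⟨_, l, hl, rfl⟩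
    exact ⟨l, Finset.mem_coe.2 (Finset.mem_range.2 (Nat.lt_succ_of_le hl)), rfl⟩
  rw [Fintype.card_eq_nat_card, Nat.card_coe_set_eq]
  calc _ ≤ (grid n '' Finset.range (n + 1)).ncard := Set.ncard_le_ncard hsub (Set.toFinite _)
    _ ≤ (Finset.range (n + 1) : Set ℕ).ncard := Set.ncard_image_le (Set.toFinite _)
    _ = n + 1 := by rw [Set.ncard_coe_finset, Finset.card_range]

/-! ### Two-point lower bound -/

section LowerBound

variable {p n : ℕ} {S : SamplingScheme p n} {m : Fin p → ℝ} {w : ℝ} {h0 : 0 ≤ w} {h1 : w ≤ 1}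

lemma noiseLaw_zero : noiseLaw S w {fun _ ↦ 0} =
    ENNReal.ofReal (1 - w) ^ Fintype.card S.obsTimes := by
  rw [noiseLaw, ← Set.univ_pi_singleton, Measure.pi_pi]
  simp [threePoint_zero]

lemma noiseVar_zero (m : Fin p → ℝ) (h : Fin p) (t : I) :
    noiseVar (S := S) m h t (fun _ ↦ 0) = 0 := by
  simp [noiseVar, sgn]

lemma noiseModel_data_zero (i j : Fin p) :
    (noiseModel S m h0 h1).data i j (fun _ ↦ 0) = 0 := by
  ext k
  have hY : ∀ h k, (noiseModel S m h0 h1).Y h k (fun _ ↦ 0) = 0 := fun h k ↦ by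
    have : (noiseModel S m h0 h1).Y h k (fun _ ↦ 0) =
      0 + noiseVar (S := S) m h (S.time h k) (fun _ ↦ 0) := rfl
    rw [this, noiseVar_zero, add_zero]
  simp [Model.data, Model.Qρ, hY]

lemma noiseModel_data_of_scale_zero (i j : Fin p) (ω : S.obsTimes → Fin 3) :
    (noiseModel S (fun _ ↦ 0) h0 h1).data i j ω = 0 := by
  ext k
  have hY : ∀ h k, (noiseModel S (fun _ ↦ 0) h0 h1).Y h k ω = 0 := fun h k ↦ by
    have : (noiseModel S (fun _ ↦ 0) h0 h1).Y h k ω =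
      0 + noiseVar (S := S) (fun _ ↦ 0) h (S.time h k) ω := rfl
    rw [this]
    simp [noiseVar]
  change 1 / 2 * ((noiseModel S (fun _ ↦ 0) h0 h1).Y i (k + 1 + 1) ω -
    (noiseModel S (fun _ ↦ 0) h0 h1).Y i (k + 1) ω) * _ = 0
  simp [hY]

lemma noiseModel_ρ (g : ℝ → ℝ) (K : ℕ) (i j : Fin p) : (noiseModel S m h0 h1).ρ g K i j =
    S.syncCount i j / (phi g K * K) * zeta g K * (m i * m j * w) := rfl

/-- No estimator can tell the noise model from the noiseless one on the event that all noise
variables vanish. -/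
lemma two_point_lower_bound (h0 : 0 ≤ w) (h1 : w ≤ 1) {g : ℝ → ℝ} {K : ℕ} {i j : Fin p}
    {r δ : ℝ} (hδ1 : δ ≤ 1) (hδ : ENNReal.ofReal δ ≤ noiseLaw S w {fun _ ↦ 0})
    (hr : 2 * r ≤ (noiseModel S m h0 h1).ρ g K i j) (ρhat : (Fin (n - 1) → ℝ) → ℝ) :
    ∃ m' : Fin p → ℝ, (m' = m ∨ m' = fun _ ↦ 0) ∧ ENNReal.ofReal δ ≤
      (noiseModel S m' h0 h1).P {ω | r ≤ |ρhat ((noiseModel S m' h0 h1).data i j ω) -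
        (noiseModel S m' h0 h1).ρ g K i j|} := by
  -- `ρhat 0` decides which model fails: if it is far from `0`, the noiseless model errs surely;
  -- otherwise the noisy model errs whenever all noises vanish.
  by_cases h : r ≤ |ρhat 0|
  · refine ⟨fun _ ↦ 0, .inr rfl, ?_⟩
    have hp := isProbabilityMeasure_noiseLaw (S := S) h0 h1
    have hset : {ω | r ≤ |ρhat ((noiseModel S (fun _ ↦ 0) h0 h1).data i j ω) -
        (noiseModel S (fun _ ↦ 0) h0 h1).ρ g K i j|} = (Set.univ : Set (S.obsTimes → Fin 3)) := by
      refine Set.eq_univ_of_forall fun ω ↦ ?_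
      change r ≤ |ρhat ((noiseModel S (fun _ ↦ 0) h0 h1).data i j ω) -
        (noiseModel S (fun _ ↦ 0) h0 h1).ρ g K i j|
      have hd := noiseModel_data_of_scale_zero (h0 := h0) (h1 := h1) i j ω
      rw [hd, noiseModel_ρ]
      simpa using h
    rw [hset]
    change ENNReal.ofReal δ ≤ noiseLaw S w Set.univ
    rw [measure_univ]
    exact ENNReal.ofReal_le_one.2 hδ1
  · refine ⟨m, .inl rfl, hδ.trans (measure_mono ?_)⟩
    rintro ω rfl
    change r ≤ |ρhat ((noiseModel S m h0 h1).data i j (fun _ ↦ 0)) -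
      (noiseModel S m h0 h1).ρ g K i j|
    rw [noiseModel_data_zero, abs_sub_comm]
    push Not at h
    have := abs_lt.1 h
    exact le_trans (by linarith) (le_abs_self _)

end LowerBound

/-! ### Calibration of the contamination probability and the noise scales -/

/-- For `w ≤ 1/2` one has `(1 - w)(1 + 2w) ≥ 1`, hence `1 - w ≥ exp (-2w)`. -/
lemma exp_neg_le_one_sub_pow {w : ℝ} (h0 : 0 ≤ w) (h1 : w ≤ 1 / 2) {k N : ℕ} (hk : k ≤ N) :
    Real.exp (-(2 * w * N)) ≤ (1 - w) ^ k := by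
  have h2 : Real.exp (-(2 * w)) ≤ 1 - w := by
    have a1 := Real.add_one_le_exp (2 * w)
    have a2 : Real.exp (-(2 * w)) * Real.exp (2 * w) = 1 := by rw [← Real.exp_add]; simp
    have a3 := Real.exp_pos (-(2 * w))
    by_contra! h
    nlinarith
  calc Real.exp (-(2 * w * N)) = Real.exp (-(2 * w)) ^ N := by
        rw [← Real.exp_nat_mul]; congr 1; ring
    _ ≤ (1 - w) ^ N := by gcongr
    _ ≤ (1 - w) ^ k := pow_le_pow_of_le_one (by linarith) (by linarith) hk

lemma tailIndex_eq {a b : ℝ} (h : tailIndex a b < 2) : tailIndex a b = 2 * a * b / (a + b) := by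
  rw [tailIndex] at h ⊢
  rcases min_lt_iff.1 h with h | h
  · exact absurd h (lt_irrefl _)
  · exact min_eq_right h.le

/-- The size of the covariance `m_i m_j w` when `m_i^{2a} = m_j^{2b} = κ / w`. -/
lemma scale_mul_scale {a b κ w : ℝ} (ha : 1 ≤ a) (hb : 1 ≤ b) (hκ : 0 < κ) (hw : 0 < w)
    (h : tailIndex a b < 2) :
    (κ / w) ^ (1 / (2 * a)) * (κ / w) ^ (1 / (2 * b)) * w =
      κ ^ (1 / tailIndex a b) * w ^ ((tailIndex a b - 1) / tailIndex a b) := by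
  have ha0 : a ≠ 0 := by linarith
  have hb0 : b ≠ 0 := by linarith
  have hab : a + b ≠ 0 := by linarith
  have hinv : 1 / (2 * a) + 1 / (2 * b) = 1 / tailIndex a b := by
    rw [tailIndex_eq h]; field_simp; ring
  have ht : tailIndex a b ≠ 0 := by
    rw [tailIndex_eq h]; positivity
  have he : (tailIndex a b - 1) / tailIndex a b = 1 - 1 / tailIndex a b := by field_simp
  rw [← Real.rpow_add (by positivity), hinv, Real.div_rpow hκ.le hw.le, he, Real.rpow_sub hw,
    Real.rpow_one]
  ring

lemma scale_sq_rpow {a κ w : ℝ} (ha : 1 ≤ a) (hκ : 0 < κ) (hw : 0 < w) :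
    (((κ / w) ^ (1 / (2 * a))) ^ 2) ^ a = κ / w := by
  have hq : 0 ≤ κ / w := by positivity
  rw [← Real.rpow_natCast, ← Real.rpow_mul hq, ← Real.rpow_mul hq]
  have : 1 / (2 * a) * ((2 : ℕ) : ℝ) * a = 1 := by
    have : a ≠ 0 := by linarith
    push_cast; field_simp
  rw [this, Real.rpow_one]

/-- A small enough `κ` meets both moment constraints at the tail index `a`. -/
lemma exists_noise_scale {νQ νρ : ℝ} (hνQ : 0 < νQ) (hνρ : 0 < νρ) {H D a : ℝ} (hH : 0 < H)
    (ha : 1 ≤ a) :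
    ∃ κ₀ : ℝ, 0 < κ₀ ∧ ∀ κ, 0 < κ → κ ≤ κ₀ → ∀ w, 0 < w → ∀ m : ℝ, (m ^ 2) ^ a = κ / w →
      (2 : ℝ) ^ a * (m ^ 2) ^ a * (2 * w) ≤ νρ ∧
      ∃ C : ℝ, 0 ≤ C ∧ (∀ x : ℝ, x = 0 ∨ 1 ≤ x → x ^ (2 * a) ≤ C * (Real.exp x - 1)) ∧
        H ^ a * (m ^ 2) ^ a * w * (C * (2 * Real.exp (2 * D))) ≤ νQ := by
  obtain ⟨C, hC, hCx⟩ := exists_rpow_le_exp_sub_one (show 0 < 2 * a by linarith)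
  have hd1 : (0 : ℝ) < 2 ^ a * 2 := by positivity
  have hd2 : 0 < H ^ a * (C * (2 * Real.exp (2 * D))) := by positivity
  -- One entry per moment constraint. In both, `(m ^ 2) ^ a * w = κ`, so the bound on `κ` does not
  -- involve `w`, hence neither `n` nor `δ`.
  refine ⟨min (νρ / (2 ^ a * 2)) (νQ / (H ^ a * (C * (2 * Real.exp (2 * D))))),
    lt_min (by positivity) (by positivity), fun κ _ hκ w hw m hm ↦ ?_⟩
  have k1 := (le_div_iff₀ hd1).1 (hκ.trans (min_le_left _ _))
  have k2 := (le_div_iff₀ hd2).1 (hκ.trans (min_le_right _ _))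
  rw [hm]
  refine ⟨le_trans (le_of_eq ?_) k1, C, hC.le, hCx, le_trans (le_of_eq ?_) k2⟩
  · field_simp
  · field_simp

end RobustVol

end

theorem theorem4p4
    (g : ℝ → ℝ) (hg : RobustVol.IsWeight g)
    (CK : ℝ) (hCK : 0 < CK)
    (νμ νγ νI νQ νρ CΔ : ℝ) (hνμ : 0 < νμ) (hνγ : 0 < νγ) (hνI : 0 < νI)
    (hνQ : 0 < νQ) (hνρ : 0 < νρ) (hCΔ : 1 ≤ CΔ)
    (a b : ℝ) (ha : 1 ≤ a) (hb : 1 ≤ b)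
    (hab₁ : 1 < RobustVol.tailIndex a b) (hab₂ : RobustVol.tailIndex a b < 2) :
    ∃ C : ℝ, 0 < C ∧ ∀ c : ℝ, 0 < c → ∃ n₀ : ℕ, ∀ n : ℕ, n₀ ≤ n →
      ∀ K : ℕ, |(K : ℝ) - CK * Real.sqrt n| < 1 →
      ∀ δ : ℝ, 0 < δ → (n : ℝ) ^ c ≤ δ⁻¹ → δ⁻¹ ≤ Real.exp (Real.sqrt n) →
      ∀ (p : ℕ) (α : Fin p → ℝ), (∀ h, 1 ≤ α h) →
      ∀ i j : Fin p, α i = a → α j = b →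
      ∃ S : RobustVol.SamplingScheme p n, S.MeshBound CΔ ∧
      ∀ ρhat : (Fin (n - 1) → ℝ) → ℝ, Measurable ρhat →
      ∃ M : RobustVol.Model S,
        M.BoundedCoeff νμ νγ νI ∧ M.MomentQ g K α νQ ∧ M.MomentQρ α νρ ∧
        ENNReal.ofReal δ ≤
          M.P {ω | C * (Real.log δ⁻¹ / n) ^
              ((RobustVol.tailIndex a b - 1) / RobustVol.tailIndex a b)
            ≤ |ρhat (M.data i j ω) - M.ρ g K i j|} := by
  open RobustVol in
  obtain ⟨B, φ₀, ζ₀, hB, hφ₀, hζ₀, K₀, hK₀, hbd⟩ := hg.exists_bounds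
  -- `F` comes from `K ≥ CK √n / 2` and `φ ≥ φ₀`; `D` bounds `K w`, as `K ≤ (CK + 1) √n` and `w ≤ 1
  -- / (4 √n)`.
  set F : ℝ := 4 / (CK ^ 2 * φ₀) with hF
  set D : ℝ := (CK + 1) / 4 with hD
  have hH : 0 < F * B ^ 2 := by positivity
  obtain ⟨κa, hκa, hka⟩ := exists_noise_scale hνQ hνρ (D := D) hH ha
  obtain ⟨κb, hκb, hkb⟩ := exists_noise_scale hνQ hνρ (D := D) hH hb
  set κ := min κa κb
  have hκ : 0 < κ := lt_min hκa hκb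
  set e := (tailIndex a b - 1) / tailIndex a b
  set A : ℝ := ζ₀ / (B ^ 2 * (CK + 1) ^ 2) with hA
  have hA0 : 0 < A := by positivity
  -- `A` bounds `n ζ / (φ K)` from below, `(1/4) ^ e` comes from the `4` in `w`, and the halving
  -- from the separation `2r`. The threshold on `n` forces `CK √n ≥ 2 (K₀ + 1)`, hence `K ≥ K₀` and
  -- `K ≥ CK √n / 2`, and also `n > 1`.
  refine ⟨A * (κ ^ (1 / tailIndex a b) * (1 / 4) ^ e) / 2, by positivity, fun c hc ↦
    ⟨⌈(2 * ((K₀ : ℝ) + 1) / CK) ^ 2⌉₊ + 2, fun n hn K hK δ hδ0 hδc hδe p α hα i j hi hj ↦ ?_⟩⟩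
  -- sizes of `n`, `K` and the contamination probability `w`
  have hn0 : 0 < n := by omega
  have hn1 : (1 : ℝ) < n := by exact_mod_cast (by omega : 1 < n)
  have hnpos : (0 : ℝ) < n := by linarith
  have hs : Real.sqrt n ^ 2 = n := Real.sq_sqrt hnpos.le
  have hs1 : 1 ≤ Real.sqrt n := Real.one_le_sqrt.2 hn1.le
  have hsK : 2 * ((K₀ : ℝ) + 1) / CK ≤ Real.sqrt n := by
    apply Real.le_sqrt_of_sq_le
    exact (Nat.le_ceil _).trans (Nat.cast_le.2 (by omega))
  rw [div_le_iff₀ hCK] at hsK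
  obtain ⟨hKl, hKu⟩ := abs_lt.1 hK
  have hK₀0 : (0 : ℝ) ≤ K₀ := by positivity
  have hKlow : CK * Real.sqrt n / 2 ≤ K := by linarith
  have hKup : (K : ℝ) ≤ (CK + 1) * Real.sqrt n := by linarith
  have hKK₀ : K₀ ≤ K := by
    have : (K₀ : ℝ) ≤ K := by linarith
    exact_mod_cast this
  have hKpos : 0 < K := by omega
  have hK' : (0 : ℝ) < K := by exact_mod_cast hKpos
  obtain ⟨hφl, hφu, hζ, hinc⟩ := hbd K hKK₀
  have hφpos : 0 < phi g K := by linarith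
  have hδinv : 1 < δ⁻¹ := (Real.one_lt_rpow hn1 hc).trans_le hδc
  set ℓ := Real.log δ⁻¹ with hℓ
  have hℓ0 : 0 < ℓ := Real.log_pos hδinv
  have hℓs : ℓ ≤ Real.sqrt n := by
    rw [hℓ, Real.log_le_iff_le_exp (by positivity)]; exact hδe
  -- Chosen so that `exp (-(2 w * 2n)) = δ`, with `2n` bounding the `n + 1` observation times.
  set w : ℝ := ℓ / (4 * n) with hw
  have hw0 : 0 < w := by positivity
  have hw4 : w * (4 * Real.sqrt n) ≤ 1 := by
    have h4 : w * (4 * n) = ℓ := div_mul_cancel₀ _ (by positivity)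
    refine le_of_mul_le_mul_right ?_ (zero_lt_one.trans_le hs1)
    calc w * (4 * Real.sqrt n) * Real.sqrt n = w * (4 * Real.sqrt n ^ 2) := by ring
      _ ≤ 1 * Real.sqrt n := by rw [hs, h4, one_mul]; exact hℓs
  have hw1 : w ≤ 1 / 2 := by linarith [le_mul_of_one_le_right hw0.le hs1]
  have hKw : K * w ≤ D := by
    calc K * w ≤ (CK + 1) * Real.sqrt n * w := by gcongr
      _ = (CK + 1) / 4 * (w * (4 * Real.sqrt n)) := by ring
      _ ≤ D := mul_le_of_le_one_right (by positivity) hw4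
  have hFn : (n : ℝ) ≤ F * K ^ 2 * phi g K := by
    have hK2 : CK ^ 2 * n / 4 ≤ (K : ℝ) ^ 2 := by
      have : (CK * Real.sqrt n / 2) ^ 2 ≤ (K : ℝ) ^ 2 := by gcongr
      rw [div_pow, mul_pow, hs] at this
      linarith
    calc (n : ℝ) = F * (CK ^ 2 * n / 4) * φ₀ := by rw [hF]; field_simp
      _ ≤ F * K ^ 2 * phi g K := by gcongr
  -- the scheme and the two models
  set m : Fin p → ℝ := fun h ↦ if h = i then (κ / w) ^ (1 / (2 * a)) else
    if h = j then (κ / w) ^ (1 / (2 * b)) else 0 with hm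
  have hmi : m i = (κ / w) ^ (1 / (2 * a)) := by simp [hm]
  have hmj : m j = (κ / w) ^ (1 / (2 * b)) := by
    -- When the two assets coincide, `a = b` and the two prescribed scales agree.
    by_cases hij : j = i
    · have : b = a := by rw [← hi, ← hj, hij]
      rw [hij, hmi, this]
    · simp [hm, hij]
  refine ⟨uniformScheme p hn0, uniformScheme_meshBound hn0 hCΔ, fun ρhat _ ↦ ?_⟩
  have hcase : ∀ h, m h = 0 ∨ (2 : ℝ) ^ α h * (m h ^ 2) ^ α h * (2 * w) ≤ νρ ∧
      ∃ C : ℝ, 0 ≤ C ∧ (∀ x : ℝ, x = 0 ∨ 1 ≤ x → x ^ (2 * α h) ≤ C * (Real.exp x - 1)) ∧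
        (F * B ^ 2) ^ α h * (m h ^ 2) ^ α h * w * (C * (2 * Real.exp (2 * D))) ≤ νQ := by
    intro h
    by_cases h1 : h = i
    · right
      subst h1
      rw [hi]
      exact hka κ hκ (min_le_left _ _) w hw0 _ (by rw [hmi, scale_sq_rpow ha hκ hw0])
    by_cases h2 : h = j
    · right
      subst h2
      rw [hj]
      exact hkb κ hκ (min_le_right _ _) w hw0 _ (by rw [hmj, scale_sq_rpow hb hκ hw0])
    · left; simp [hm, h1, h2]
  have hprob : ENNReal.ofReal δ ≤ noiseLaw (uniformScheme p hn0) w {fun _ ↦ 0} := by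
    rw [noiseLaw_zero, ← ENNReal.ofReal_pow (by linarith)]
    refine ENNReal.ofReal_le_ofReal ?_
    have hcard : Fintype.card (uniformScheme p hn0).obsTimes ≤ 2 * n :=
      (card_obsTimes_uniformScheme_le hn0).trans (by omega)
    refine le_trans (le_of_eq ?_) (exp_neg_le_one_sub_pow hw0.le hw1 hcard)
    have : 2 * w * ((2 * n : ℕ) : ℝ) = ℓ := by rw [hw]; push_cast; field_simp; norm_num
    rw [this, hℓ, Real.log_inv, neg_neg, Real.exp_log hδ0]
  have hρ : 2 * (A * (κ ^ (1 / tailIndex a b) * (1 / 4) ^ e) / 2 * (ℓ / n) ^ e) ≤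
      (noiseModel (uniformScheme p hn0) m hw0.le (by linarith)).ρ g K i j := by
    rw [noiseModel_ρ, uniformScheme_syncCount, hmi, hmj, scale_mul_scale ha hb hκ hw0 hab₂]
    have hwe : w ^ e = (1 / 4) ^ e * (ℓ / n) ^ e := by
      rw [← Real.mul_rpow (by norm_num) (by positivity)]
      congr 1
      rw [hw]; field_simp
    rw [hwe]
    have hA1 : A ≤ n / (phi g K * K) * zeta g K := by
      have hK2 : (K : ℝ) ^ 2 ≤ (CK + 1) ^ 2 * n := by
        have : (K : ℝ) ^ 2 ≤ ((CK + 1) * Real.sqrt n) ^ 2 := by gcongr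
        rwa [mul_pow, hs] at this
      have : n / (phi g K * K) * zeta g K = n * (K * zeta g K) / (phi g K * K ^ 2) := by
        field_simp
      have hζ0 : 0 ≤ zeta g K := Finset.sum_nonneg fun _ _ ↦ sq_nonneg _
      rw [this, hA]
      calc ζ₀ / (B ^ 2 * (CK + 1) ^ 2) = n * ζ₀ / (B ^ 2 * ((CK + 1) ^ 2 * n)) := by field_simp
        _ ≤ n * (K * zeta g K) / (phi g K * K ^ 2) := by gcongr
    calc _ = A * (κ ^ (1 / tailIndex a b) * ((1 / 4) ^ e * (ℓ / n) ^ e)) := by ring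
      _ ≤ _ := by gcongr
  obtain ⟨m', hm', hP⟩ := two_point_lower_bound (m := m) hw0.le (by linarith)
    ((one_le_inv₀ hδ0).1 hδinv.le) hprob hρ ρhat
  have hcase' : ∀ h, m' h = 0 ∨ (2 : ℝ) ^ α h * (m' h ^ 2) ^ α h * (2 * w) ≤ νρ ∧
      ∃ C : ℝ, 0 ≤ C ∧ (∀ x : ℝ, x = 0 ∨ 1 ≤ x → x ^ (2 * α h) ≤ C * (Real.exp x - 1)) ∧
        (F * B ^ 2) ^ α h * (m' h ^ 2) ^ α h * w * (C * (2 * Real.exp (2 * D))) ≤ νQ := by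
    rcases hm' with rfl | rfl
    · exact hcase
    · exact fun _ ↦ .inl rfl
  refine ⟨noiseModel (uniformScheme p hn0) m' hw0.le (by linarith),
    noiseModel_boundedCoeff hνμ.le hνγ.le hνI.le, ?_, ?_, hP⟩
  · exact noiseModel_momentQ hg.zero hg.one hKpos hinc hFn hφpos (by positivity) hKw hνQ.le hα
      fun h ↦ (hcase' h).imp_right fun H ↦ H.2
  · exact noiseModel_momentQρ hνρ.le hα fun h ↦ (hcase' h).imp_right fun H ↦ H.1
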